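/- Theorem 3.1. **Setting.** Consider a finite game with agents $\mathcal I=\{1,\dots,n\}$, $n\ge 1$, finite nonempty action sets $\mathcal A_i$, $\mathcal A=\prod_i\mathcal A_i$, and utilities $u_i:\mathcal A\to\mathbb R$. Let $\zeta>0$, $0<\epsilon<2$, $c>0$, $0<h<1$, and let $\underline\rho<\min_{i,\alpha}u_i(\alpha)\le\max_{i,\alpha}u_i(\alpha)<\overline\rho$ be real numbers. Put $\mathcal X=\mathcal A\times[\underline\rho,\overline\rho]^n$, with $\mathcal A$ discrete. Let $\mathtt{sat}[\cdot]$ be the saturation (projection) onto $[\underline\rho,\overline\rho]$, and let $\phi(z)=1$ for $z\ge0$ and $\phi(z)=\max(h,1+cz)$ for $z<0$. For $\lambda\in[0,1]$ let $P_\lambda$ be the transition kernel on $\mathcal X$ of the following step from a state $(\alpha,\rho)$ to a state $(\alpha',\rho')$, in which all random choices are independent. * Aspirations: $\rho_i'=\mathtt{sat}\bigl[\rho_i+\epsilon(u_i(\alpha)-\rho_i)+r_i\bigr]$, where $r_i=0$ with probability $1-\lambda$ and $r_i$ is uniform on $[-\zeta,\zeta]$ with probability $\lambda$. * Actions: $\alpha_i'=\alpha_i$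 with probability $\phi(u_i(\alpha)-\rho_i)$, and otherwise $\alpha_i'$ is uniform on $\mathcal A_i\setminus\{\alpha_i\}$ (an agent with only one action keeps it). Let $P=P_0$. Let $Q$ be the kernel of the same step in which exactly one agent trembles, that is, an agent $i$ is chosen uniformly, $r_i$ is uniform on $[-\zeta,\zeta]$, and $r_j=0$ for all $j\ne i$. Let $\mathcal S=\{(\alpha,\rho)\in\mathcal X: \rho_i=u_i(\alpha)\text{ for all } i\}$ be the finite set of pure strategy states. For $s=(\alpha,\rho)\in\mathcal S$ and $\delta>0$ let $N_\delta(s)=\{(\alpha,\sigma)\in\mathcal X:|\sigma_i-\rho_i|<\delta\text{ for all } i\}$. **Theorem.** For all $s,s'\in\mathcal S$ the limit $$\hat P_{ss'}=\lim_{t\to\infty}(QP^t)(s,N_\delta(s'))$$ exists for every $\delta>0$ and does not depend on $\delta$, and $\hat P=[\hat P_{ss'}]$ is a stochastic matrix. There is a unique probability vector $\pi$ on $\mathcal S$ such that, for every family $(\mu_\lambda)_{0<\lambda\le1}$ of probability measures on $\mathcal X$ with $\mu_\lambda P_\lambda=\mu_\lambda$ for all $\lambda$, $$\mu_\lambda\longrightarrow\sum_{s\in\mathcal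 S}\pi_s\delta_s\quad\text{weakly}^*\text{ as }\lambda\downarrow0 .$$ Moreover, $\pi$ is the unique probability vector on $\mathcal S$ with $\pi=\pi\hat P$. -/

import Mathlib

open MeasureTheory ProbabilityTheory Filter Topology

universe u v

set_option linter.unusedSectionVars false

/-- A finite strategic-form game with agents `ι`, action sets `A i` and utilities `u i`, together
with the constants of the aspiration-learning iteration: the size `ζ` of the trembles, the step
size `ε` of the aspiration update, the constants `c` and `h` of the response function, and the
bounds `lo`, `hi` on the aspiration levels. -/
structure AspirationLearning (ι : Type u) (A : ι → Type v) where
  u : ι → (∀ i, A i) → ℝ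
  ζ : ℝ
  ε : ℝ
  c : ℝ
  h : ℝ
  lo : ℝ
  hi : ℝ
  ζ_pos : 0 < ζ
  ε_pos : 0 < ε
  ε_lt_two : ε < 2
  c_pos : 0 < c
  h_pos : 0 < h
  h_lt_one : h < 1
  lo_lt : ∀ i α, lo < u i α
  lt_hi : ∀ i α, u i α < hi

namespace AspirationLearning

section Basic

variable {ι : Type u} {A : ι → Type v}

theorem lo_le_hi [Nonempty ι] [∀ i, Nonempty (A i)] (L : AspirationLearning ι A) :
    L.lo ≤ L.hi :=
  ((L.lo_lt (Classical.arbitrary ι) (Classical.arbitrary (∀ i, A i))).trans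
    (L.lt_hi (Classical.arbitrary ι) (Classical.arbitrary (∀ i, A i)))).le

/-- The state space: pairs of an action profile and a vector of aspiration levels. -/
abbrev State (L : AspirationLearning ι A) : Type (max u v) :=
  (∀ i, A i) × (ι → Set.Icc L.lo L.hi)

/-- The pure strategy states: every aspiration level equals the current payoff. -/
def PureState (L : AspirationLearning ι A) : Type (max u v) :=
  {x : L.State // ∀ i, L.u i x.1 = x.2 i}

noncomputable instance [Fintype ι] [DecidableEq ι] [∀ i, Fintype (A i)]
    (L : AspirationLearning ι A) : Fintype L.PureState :=
  Fintype.ofInjective (fun s : L.PureState => s.1.1) (by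
    rintro ⟨⟨α, ρ⟩, hs⟩ ⟨⟨β, σ⟩, ht⟩ hαβ
    obtain rfl : α = β := hαβ
    have hρ : ρ = σ := funext fun i => Subtype.ext ((hs i).symm.trans (ht i))
    subst hρ
    rfl)

/-- The response function `φ`. -/
noncomputable def response (L : AspirationLearning ι A) (z : ℝ) : ℝ :=
  if 0 ≤ z then 1 else max L.h (1 + L.c * z)

/-- The probability that agent `i` plays `b` next when the current state is `x`: the current action
is kept with probability `φ (u i α - ρ i)`, otherwise an action is drawn uniformly from the other
ones. An agent with only one action keeps it. -/
noncomputable def actionProb (L : AspirationLearning ι A) [∀ i, Fintype (A i)]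
    [∀ i, DecidableEq (A i)] (x : L.State) (i : ι) (b : A i) : ℝ :=
  if b = x.1 i then
    if Fintype.card (A i) = 1 then 1 else L.response (L.u i x.1 - x.2 i)
  else (1 - L.response (L.u i x.1 - x.2 i)) / ((Fintype.card (A i) : ℝ) - 1)

/-- The updated aspiration levels when the current state is `x` and the tremble vector is `r`;
`Set.projIcc` is the saturation onto `[lo, hi]`. -/
noncomputable def nextAspiration [Nonempty ι] [∀ i, Nonempty (A i)] (L : AspirationLearning ι A)
    (p : L.State × (ι → ℝ)) : ι → Set.Icc L.lo L.hi :=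
  fun i => Set.projIcc L.lo L.hi L.lo_le_hi
    (p.1.2 i + L.ε * (L.u i p.1.1 - p.1.2 i) + p.2 i)

/-- The uniform distribution on `[-ζ, ζ]`. -/
noncomputable def uniformTremble (L : AspirationLearning ι A) : Measure ℝ :=
  ProbabilityTheory.cond volume (Set.Icc (-L.ζ) L.ζ)

/-- The law of the tremble of one agent: `0` with probability `1 - lam`, and uniform on `[-ζ, ζ]`
with probability `lam` (for `0 ≤ lam ≤ 1`). -/
noncomputable def trembleLaw (L : AspirationLearning ι A) (lam : ℝ) : Measure ℝ :=
  ENNReal.ofReal (1 - lam) • Measure.dirac 0 + ENNReal.ofReal lam • L.uniformTremble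

/-- The law of independent trembles of all agents, each with tremble probability `lam`. -/
noncomputable def trembles [Fintype ι] (L : AspirationLearning ι A) (lam : ℝ) :
    Measure (ι → ℝ) :=
  Measure.pi fun _ => L.trembleLaw lam

/-- The law of the tremble vector when exactly one agent trembles, this agent being chosen
uniformly. -/
noncomputable def singleTremble [Fintype ι] [DecidableEq ι] (L : AspirationLearning ι A) :
    Measure (ι → ℝ) :=
  ENNReal.ofReal (1 / (Fintype.card ι : ℝ)) •
    ∑ i : ι, Measure.pi fun j => if j = i then L.uniformTremble else Measure.dirac 0

/-- The set of states with the same actions as `s` and with all aspiration levels at distance less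
than `δ` from those of `s`. -/
def nbhd (L : AspirationLearning ι A) (s : L.State) (δ : ℝ) : Set L.State :=
  {y | y.1 = s.1 ∧ ∀ i, |(y.2 i : ℝ) - s.2 i| < δ}

end Basic

section Chain

variable {ι : Type u} {A : ι → Type v} [Fintype ι] [DecidableEq ι]
  [∀ i, Fintype (A i)] [∀ i, DecidableEq (A i)]
  [∀ i, TopologicalSpace (A i)] [∀ i, DiscreteTopology (A i)]
  [∀ i, MeasurableSpace (A i)] [∀ i, BorelSpace (A i)]

theorem measurable_payoff (L : AspirationLearning ι A) (i : ι) : Measurable (L.u i) :=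
  measurable_of_countable _

theorem measurable_discontent (L : AspirationLearning ι A) (i : ι) :
    Measurable fun x : L.State => L.u i x.1 - (x.2 i : ℝ) :=
  ((L.measurable_payoff i).comp measurable_fst).sub
    (measurable_subtype_coe.comp ((measurable_pi_apply i).comp measurable_snd))

theorem measurable_response (L : AspirationLearning ι A) : Measurable L.response :=
  Measurable.ite measurableSet_Ici measurable_const
    (measurable_const.max (measurable_const.add (measurable_const.mul measurable_id)))

theorem measurable_actionProb (L : AspirationLearning ι A) (i : ι) (b : A i) :
    Measurable fun x : L.State => L.actionProb x i b := by
  have hφ : Measurable fun x : L.State => L.response (L.u i x.1 - (x.2 i : ℝ)) :=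
    L.measurable_response.comp (L.measurable_discontent i)
  have hb : MeasurableSet {x : L.State | b = x.1 i} :=
    measurableSet_eq_fun measurable_const ((measurable_pi_apply i).comp measurable_fst)
  unfold actionProb
  refine Measurable.ite hb ?_ ((measurable_const.sub hφ).div_const _)
  by_cases h1 : Fintype.card (A i) = 1
  · simp [h1]
  · simpa [h1] using hφ

theorem measurable_nextAspiration [Nonempty ι] [∀ i, Nonempty (A i)]
    (L : AspirationLearning ι A) : Measurable L.nextAspiration := by
  refine measurable_pi_lambda _ fun i => ?_
  have hρ : Measurable fun p : L.State × (ι → ℝ) => (p.1.2 i : ℝ) :=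
    measurable_subtype_coe.comp
      ((measurable_pi_apply i).comp (measurable_snd.comp measurable_fst))
  have hu : Measurable fun p : L.State × (ι → ℝ) => L.u i p.1.1 :=
    (L.measurable_payoff i).comp (measurable_fst.comp measurable_fst)
  exact continuous_projIcc.measurable.comp
    ((hρ.add (measurable_const.mul (hu.sub hρ))).add
      ((measurable_pi_apply i).comp measurable_snd))

/-- The law of the next action profile: the agents choose independently given the state. -/
noncomputable def actionKernel (L : AspirationLearning ι A) : Kernel L.State (∀ i, A i) where
  toFun x := ∑ b : ∀ i, A i,
    ENNReal.ofReal (∏ i, L.actionProb x i (b i)) • Measure.dirac b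
  measurable' := by
    refine Measure.measurable_of_measurable_coe _ fun s hs => ?_
    simp only [Measure.coe_finsetSum, Measure.coe_smul, Finset.sum_apply, Pi.smul_apply,
      smul_eq_mul]
    exact Finset.measurable_sum _ fun b _ => Measurable.mul_const
      (Finset.measurable_prod _ fun i _ => L.measurable_actionProb i (b i)).ennreal_ofReal _

/-- The probability measure `∑ s, π s • δ_s` on the state space. -/
noncomputable def mixture (L : AspirationLearning ι A) (π : stdSimplex ℝ L.PureState) :
    ProbabilityMeasure L.State :=
  ⟨∑ s : L.PureState, ENNReal.ofReal (π.1 s) • Measure.dirac s.1, ⟨by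
    have h : ∑ s : L.PureState, ENNReal.ofReal (π.1 s) = 1 := by
      rw [← ENNReal.ofReal_sum_of_nonneg fun s _ => π.2.1 s, π.2.2, ENNReal.ofReal_one]
    simpa [Measure.coe_finsetSum] using h⟩⟩

variable [Nonempty ι] [∀ i, Nonempty (A i)]

/-- One step of the algorithm when the tremble vector has law `ν`: given the current state, the
new actions and the new aspiration levels are independent. -/
noncomputable def stepKernel (L : AspirationLearning ι A) (ν : Measure (ι → ℝ)) :
    Kernel L.State L.State :=
  L.actionKernel ×ₖ
    ((Kernel.id ×ₖ Kernel.const L.State ν).map L.nextAspiration)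

/-- The transition kernel `P_lam` of the chain with tremble probability `lam ∈ [0, 1]`; the
unperturbed chain is `L.kernel 0`. -/
noncomputable def kernel (L : AspirationLearning ι A) (lam : ℝ) : Kernel L.State L.State :=
  L.stepKernel (L.trembles lam)

/-- The transition kernel `Q` of one step in which exactly one agent trembles. -/
noncomputable def trembleKernel (L : AspirationLearning ι A) : Kernel L.State L.State :=
  L.stepKernel L.singleTremble

/-- `π` describes the small-tremble limit: for every choice of invariant probability measures
`μ lam` of `P_lam`, `0 < lam ≤ 1`, the measures `μ lam` converge weakly to `∑ s, π s • δ_s` as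
`lam` decreases to `0`. -/
def IsLimitVector (L : AspirationLearning ι A) (π : stdSimplex ℝ L.PureState) : Prop :=
  ∀ μ : ℝ → ProbabilityMeasure L.State,
    (∀ lam ∈ Set.Ioc (0 : ℝ) 1, (L.kernel lam).Invariant (μ lam : Measure L.State)) →
      Tendsto μ (𝓝[>] 0) (𝓝 (L.mixture π))

/-- `Phat s s'` is the limit in `t`, for every radius `δ > 0`, of the probability that the chain
started at `s` is in the `δ`-neighbourhood of `s'` after one step with a single tremble followed
by `t` steps of the unperturbed chain. -/
def IsTrembleMatrix (L : AspirationLearning ι A) (Phat : Matrix L.PureState L.PureState ℝ) :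
    Prop :=
  ∀ δ > 0, ∀ s s' : L.PureState,
    Tendsto (fun t : ℕ => (((L.kernel 0) ^ t) ∘ₖ L.trembleKernel) s.1 |>.real (L.nbhd s'.1 δ))
      atTop (𝓝 (Phat s s'))

end Chain

end AspirationLearning

/-!
Write `P` for the unperturbed chain, `Q` for a step with a single tremble, `d` for the total
distance between aspirations and current payoffs, and `n` for the number of agents.

**Unperturbed chain.** While the actions are frozen, `d` contracts by the factor `|1 - ε| < 1`, and
the actions freeze for one more step with probability at least `exp (-(c / h) d)`. Hence they freeze
forever with probability at least `exp (-K d)`, where `K = (c / h) / (1 - |1 - ε|)`. This gives the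
Lyapunov function `V = d + B (1 - exp (-K d))`, which vanishes exactly on the pure states and
satisfies `P V ≤ r V` with `r < 1` (`exists_freeOp_lyapunov_le`). The indicator `1_a` of an action
profile satisfies `|P 1_a - 1_a| ≤ (c / h) V`, so `P ^ t 1_a` converges uniformly and geometrically
to a continuous `P`-harmonic function `F_a` (`limitProb`) that equals `1_a` on the pure states. As
the chain is Feller, `P̂ s s' = (Q F_{s'}) s` is then the tremble matrix.

**Irreducibility.** A positive tremble of one agent at a pure state makes it dissatisfied, so it may
switch to any other action, after which all actions may freeze. So `P̂` charges all unilateral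
deviations, and any two profiles are joined by these. Hence `P̂` has exactly one stationary
probability vector.

**Invariant measures.** Splitting a step of `P_lam` according to the set of trembling agents,
invariance of `μ` gives two estimates. Applied to `V`, it gives `μ V = O(lam)`, so `μ` concentrates
near the pure states, and a continuous function that vanishes there has integral `o(1)`. Applied to
`F_a = P F_a`, the terms without trembles cancel and those with two or more trembles have weight
`O(lam ^ 2)`, so `μ F_a - μ Q F_a = O(lam)`. Replacing `F_a` and `Q F_a` by the functions of the
profile that agree with them on the pure states, one sees that the vector of profile probabilities
of `μ` is asymptotically stationary for `P̂`. By compactness of the simplex it converges to the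
stationary vector of `P̂`, and this determines the weak limit of `μ`.
-/

/-! ### Feller kernels on compact spaces -/

namespace ProbabilityTheory.Kernel

section Feller

variable {X : Type*} [TopologicalSpace X] [CompactSpace X] [MeasurableSpace X] [BorelSpace X]

theorem integrable_continuousMap (m : Measure X) [IsFiniteMeasure m] (f : C(X, ℝ)) :
    Integrable f m :=
  f.continuous.integrable_of_hasCompactSupport (HasCompactSupport.of_compactSpace f)

theorem abs_integral_continuousMap_le (m : Measure X) [IsProbabilityMeasure m] (f : C(X, ℝ)) :
    |∫ x, f x ∂m| ≤ ‖f‖ := by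
  have h := norm_integral_le_of_norm_le_const (μ := m) (f := f) (C := ‖f‖)
    (Eventually.of_forall fun x => f.norm_coe_le_norm x)
  simpa using h

/-- A kernel is Feller if it maps continuous functions to continuous functions. -/
def IsFeller (κ : Kernel X X) : Prop :=
  ∀ f : C(X, ℝ), Continuous fun x => ∫ y, f y ∂κ x

/-- The Markov operator `f ↦ (x ↦ ∫ f dκ(x))` of a Feller kernel, on continuous functions. -/
noncomputable def fellerOp (κ : Kernel X X) [IsMarkovKernel κ] (hκ : κ.IsFeller) :
    C(X, ℝ) →L[ℝ] C(X, ℝ) :=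
  LinearMap.mkContinuous
    { toFun := fun f => ⟨fun x => ∫ y, f y ∂κ x, hκ f⟩
      map_add' := fun f g => by
        ext x
        exact integral_add (integrable_continuousMap _ f) (integrable_continuousMap _ g)
      map_smul' := fun a f => by
        ext x
        exact integral_const_mul a f } 1 fun f => by
    rw [one_mul]
    refine (ContinuousMap.norm_le _ (norm_nonneg f)).2 fun x => ?_
    exact abs_integral_continuousMap_le (κ x) f

section Operator

variable (κ : Kernel X X) [IsMarkovKernel κ] (hκ : κ.IsFeller)

theorem fellerOp_apply (f : C(X, ℝ)) (x : X) : fellerOp κ hκ f x = ∫ y, f y ∂κ x := rfl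

theorem fellerOp_mono {f g : C(X, ℝ)} (h : ∀ x, f x ≤ g x) (x : X) :
    fellerOp κ hκ f x ≤ fellerOp κ hκ g x :=
  integral_mono (integrable_continuousMap _ f) (integrable_continuousMap _ g) h

theorem fellerOp_pow_mono {f g : C(X, ℝ)} (h : ∀ x, f x ≤ g x) (t : ℕ) :
    ∀ x, (fellerOp κ hκ ^ t) f x ≤ (fellerOp κ hκ ^ t) g x := by
  induction t with
  | zero => simpa using h
  | succ t ih =>
    intro x
    rw [pow_succ']
    exact fellerOp_mono κ hκ ih x

theorem abs_fellerOp_pow_le {f g : C(X, ℝ)} (h : ∀ x, |f x| ≤ g x) (t : ℕ) (x : X) :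
    |(fellerOp κ hκ ^ t) f x| ≤ (fellerOp κ hκ ^ t) g x := by
  refine abs_le.2 ⟨?_, fellerOp_pow_mono κ hκ (fun y => (le_abs_self _).trans (h y)) t x⟩
  have h1 := fellerOp_pow_mono κ hκ (f := -g) (g := f)
    (fun y => neg_le_of_neg_le ((neg_le_abs _).trans (h y))) t x
  simpa using h1

theorem fellerOp_one : fellerOp κ hκ 1 = 1 := by
  ext x
  simp [fellerOp_apply]

theorem fellerOp_pow_one (t : ℕ) : (fellerOp κ hκ ^ t) 1 = 1 := by
  induction t with
  | zero => rfl
  | succ t ih => rw [pow_succ, mul_apply_eq_comp, fellerOp_one, ih]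

instance isMarkovKernel_pow (t : ℕ) : IsMarkovKernel (κ ^ t) := by
  induction t with
  | zero => rw [pow_zero]; exact inferInstanceAs (IsMarkovKernel Kernel.id)
  | succ t ih =>
    rw [pow_succ]
    exact inferInstanceAs (IsMarkovKernel ((κ ^ t) ∘ₖ κ))

theorem integral_pow (f : C(X, ℝ)) (t : ℕ) (x : X) :
    ∫ y, f y ∂(κ ^ t) x = (fellerOp κ hκ ^ t) f x := by
  induction t generalizing x with
  | zero =>
    have h : (κ ^ 0) x = Measure.dirac x := by
      rw [pow_zero]; exact Kernel.id_apply x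
    rw [h, pow_zero]
    exact integral_dirac' _ _ f.continuous.stronglyMeasurable
  | succ t ih =>
    have h : κ ^ (t + 1) = (κ ^ t) ∘ₖ κ := pow_succ κ t
    rw [h, Kernel.integral_comp (integrable_continuousMap _ f), pow_succ']
    simp_rw [ih]
    rfl

theorem integral_fellerOp (m : Measure X) [IsProbabilityMeasure m] (f : C(X, ℝ)) :
    ∫ x, fellerOp κ hκ f x ∂m = ∫ x, f x ∂m.bind κ := by
  have h : m.bind κ = (κ ∘ₖ Kernel.const Unit m) () := by
    rw [Kernel.comp_apply, Kernel.const_apply]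
  have hm : IsProbabilityMeasure (m.bind κ) := by rw [h]; infer_instance
  rw [h, Kernel.integral_comp (by rw [← h]; exact integrable_continuousMap _ f)]
  rfl

theorem Invariant.integral_fellerOp {m : Measure X} [IsProbabilityMeasure m]
    (hm : κ.Invariant m) (f : C(X, ℝ)) :
    ∫ x, fellerOp κ hκ f x ∂m = ∫ x, f x ∂m := by
  rw [Kernel.integral_fellerOp, hm.def]

theorem fellerOp_pow_le {V : C(X, ℝ)} {r : ℝ} (hr : 0 ≤ r)
    (hV : ∀ x, fellerOp κ hκ V x ≤ r * V x) (t : ℕ) (x : X) :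
    (fellerOp κ hκ ^ t) V x ≤ r ^ t * V x := by
  induction t with
  | zero => simp
  | succ t ih =>
    have h1 : (fellerOp κ hκ ^ (t + 1)) V x ≤ (fellerOp κ hκ ^ t) (r • V) x := by
      rw [pow_succ]
      exact fellerOp_pow_mono κ hκ (g := r • V) hV t x
    rw [map_smul, ContinuousMap.smul_apply, smul_eq_mul] at h1
    rw [pow_succ' r, mul_assoc]
    exact h1.trans (mul_le_mul_of_nonneg_left ih hr)

variable {κ} in
/-- The Krylov–Bogolyubov theorem: a Feller kernel on a nonempty compact space has an invariant
probability measure, namely any cluster point of the averaged laws of the chain. -/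
theorem exists_invariant_of_isFeller [TopologicalSpace.MetrizableSpace X] [Nonempty X]
    (hκ : κ.IsFeller) :
    ∃ m : ProbabilityMeasure X, κ.Invariant (m : Measure X) := by
  let _ : MetricSpace X := TopologicalSpace.metrizableSpaceMetric X
  obtain ⟨x⟩ := ‹Nonempty X›
  -- the average of the laws at the times `0, …, N`
  let avg : ℕ → Measure X := fun N =>
    ENNReal.ofReal (1 / ((N : ℝ) + 1)) • ∑ t ∈ Finset.range (N + 1), (κ ^ t) x
  have havg : ∀ N, IsProbabilityMeasure (avg N) := fun N => ⟨by
    have : (0 : ℝ) < (N : ℝ) + 1 := by positivity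
    simp only [avg, Measure.coe_smul, Measure.coe_finsetSum, Pi.smul_apply, Finset.sum_apply,
      measure_univ, Finset.sum_const, Finset.card_range, nsmul_eq_mul, mul_one, smul_eq_mul]
    rw [← ENNReal.ofReal_natCast, ← ENNReal.ofReal_mul (by positivity), ← ENNReal.ofReal_one]
    congr 1
    push_cast
    field_simp⟩
  let a : ℕ → ProbabilityMeasure X := fun N => ⟨avg N, havg N⟩
  have hint : ∀ (N : ℕ) (f : C(X, ℝ)), ∫ y, f y ∂avg N =
      1 / ((N : ℝ) + 1) * ∑ t ∈ Finset.range (N + 1), (fellerOp κ hκ ^ t) f x := by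
    intro N f
    simp only [avg]
    rw [integral_smul_measure, integral_finsetSum_measure
      (fun t _ => integrable_continuousMap _ f), ENNReal.toReal_ofReal (by positivity)]
    simp_rw [integral_pow κ hκ]
    rfl
  obtain ⟨m, hm⟩ : ∃ m, MapClusterPt m atTop a := exists_clusterPt_of_compactSpace _
  refine ⟨m, ?_⟩
  have hbind : IsProbabilityMeasure ((m : Measure X).bind κ) := by
    have h : (m : Measure X).bind κ = (κ ∘ₖ Kernel.const Unit (m : Measure X)) () := by
      rw [Kernel.comp_apply, Kernel.const_apply]
    rw [h]; infer_instance
  refine ext_of_forall_integral_eq_of_IsFiniteMeasure fun g => ?_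
  let f : C(X, ℝ) := g.toContinuousMap
  change ∫ y, f y ∂(m : Measure X).bind κ = ∫ y, f y ∂(m : Measure X)
  rw [← integral_fellerOp κ hκ]
  let k : C(X, ℝ) := fellerOp κ hκ f - f
  have hk : ∀ N : ℕ, |∫ y, k y ∂avg N| ≤ 1 / ((N : ℝ) + 1) * (2 * ‖f‖) := by
    intro N
    rw [hint, abs_mul, abs_of_pos (by positivity)]
    refine mul_le_mul_of_nonneg_left ?_ (by positivity)
    have hs : ∀ t, (fellerOp κ hκ ^ t) k x =
        (fellerOp κ hκ ^ (t + 1)) f x - (fellerOp κ hκ ^ t) f x := by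
      intro t
      simp only [k, map_sub, pow_succ]
      rfl
    have hb : ∀ t, |(fellerOp κ hκ ^ t) f x| ≤ ‖f‖ := fun t => by
      rw [← integral_pow κ hκ]; exact abs_integral_continuousMap_le _ f
    simp_rw [hs]
    rw [Finset.sum_range_sub (fun t => (fellerOp κ hκ ^ t) f x)]
    refine (abs_sub _ _).trans ?_
    linarith [hb (N + 1), hb 0]
  have hcont : Continuous fun m' : ProbabilityMeasure X => ∫ y, k y ∂(m' : Measure X) :=
    continuous_iff_continuousAt.2 fun m' =>
      ProbabilityMeasure.tendsto_iff_forall_integral_tendsto.1 tendsto_id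
        (BoundedContinuousFunction.mkOfCompact k)
  have hlim : Tendsto (fun N : ℕ => ∫ y, k y ∂avg N) atTop (𝓝 0) := by
    refine squeeze_zero_norm hk ?_
    simpa using (tendsto_one_div_add_atTop_nhds_zero_nat (𝕜 := ℝ)).mul_const (2 * ‖f‖)
  have hcl : MapClusterPt (∫ y, k y ∂(m : Measure X)) atTop
      ((fun m' : ProbabilityMeasure X => ∫ y, k y ∂(m' : Measure X)) ∘ a) :=
    hm.continuousAt_comp hcont.continuousAt
  have hz : ∫ y, k y ∂(m : Measure X) = 0 := by
    have h2 : MapClusterPt (∫ y, k y ∂(m : Measure X)) atTop fun N : ℕ => ∫ y, k y ∂avg N := hcl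
    exact eq_of_nhds_neBot (ClusterPt.mono h2 hlim)
  have := integral_sub (integrable_continuousMap (m : Measure X) (fellerOp κ hκ f))
    (integrable_continuousMap (m : Measure X) f)
  exact sub_eq_zero.1 (this.symm.trans hz)

/-- If `V` decreases geometrically under a Markov operator and one step changes `f` by at most a
multiple of `V`, then the iterates of `f` converge uniformly, to a harmonic function which agrees
with `f` wherever `V` vanishes. -/
theorem exists_harmonic_limit {V f : C(X, ℝ)} {r C : ℝ} (hr0 : 0 ≤ r) (hr1 : r < 1)
    (hC : 0 ≤ C) (hV : ∀ x, fellerOp κ hκ V x ≤ r * V x)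
    (hf : ∀ x, |fellerOp κ hκ f x - f x| ≤ C * V x) :
    ∃ F : C(X, ℝ), Tendsto (fun t => (fellerOp κ hκ ^ t) f) atTop (𝓝 F) ∧
      fellerOp κ hκ F = F ∧ ∀ x, V x = 0 → F x = f x := by
  set T := fellerOp κ hκ with hT
  have hstep : ∀ t x, |(T ^ (t + 1)) f x - (T ^ t) f x| ≤ C * (r ^ t * V x) := by
    intro t x
    have h1 : (T ^ (t + 1)) f x - (T ^ t) f x = (T ^ t) (T f - f) x := by
      rw [map_sub, pow_succ]; rfl
    have h2 := abs_fellerOp_pow_le κ hκ (f := T f - f) (g := C • V) hf t x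
    rw [h1]
    refine h2.trans ?_
    rw [map_smul, ContinuousMap.smul_apply, smul_eq_mul]
    exact mul_le_mul_of_nonneg_left (fellerOp_pow_le κ hκ hr0 hV t x) hC
  have hcauchy : CauchySeq fun t => (T ^ t) f := by
    refine cauchySeq_of_le_geometric r (C * ‖V‖) hr1 fun t => ?_
    rw [dist_comm, dist_eq_norm]
    refine (ContinuousMap.norm_le _ (by positivity)).2 fun x => ?_
    refine (hstep t x).trans ?_
    have := (le_abs_self _).trans (V.norm_coe_le_norm x)
    calc C * (r ^ t * V x) ≤ C * (r ^ t * ‖V‖) := by gcongr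
      _ = C * ‖V‖ * r ^ t := by ring
  obtain ⟨F, hF⟩ := cauchySeq_tendsto_of_complete hcauchy
  refine ⟨F, hF, ?_, fun x hx => ?_⟩
  · have h1 : Tendsto (fun t => T ((T ^ t) f)) atTop (𝓝 (T F)) :=
      (T.continuous.tendsto F).comp hF
    have h2 : (fun t => T ((T ^ t) f)) = fun t => (T ^ (t + 1)) f := by
      funext t; rw [pow_succ']; rfl
    rw [h2] at h1
    exact tendsto_nhds_unique h1 (hF.comp (tendsto_add_atTop_nat 1))
  · have hc : ∀ t, (T ^ t) f x = f x := by
      intro t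
      induction t with
      | zero => rfl
      | succ t ih =>
        have := hstep t x
        rw [hx, mul_zero, mul_zero] at this
        rw [← ih]
        exact sub_eq_zero.1 (abs_nonpos_iff.1 this)
    have h1 : Tendsto (fun t => (T ^ t) f x) atTop (𝓝 (F x)) :=
      ((ContinuousEvalConst.continuous_eval_const x).tendsto F).comp hF
    simp_rw [hc] at h1
    exact tendsto_nhds_unique tendsto_const_nhds h1 |>.symm

end Operator

end Feller

end ProbabilityTheory.Kernel

/-- A continuous function that vanishes on the zero set of `V ≥ 0` has small integral against
measures for which the integral of `V` is small. -/
theorem tendsto_integral_of_eq_zero_of_tendsto {X Λ : Type*} [TopologicalSpace X] [CompactSpace X]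
    [MeasurableSpace X] [BorelSpace X] {l : Filter Λ} {m : Λ → ProbabilityMeasure X}
    {V g : C(X, ℝ)} (hV : ∀ x, 0 ≤ V x) (hg : ∀ x, V x = 0 → g x = 0)
    (hm : Tendsto (fun a => ∫ x, V x ∂(m a : Measure X)) l (𝓝 0)) :
    Tendsto (fun a => ∫ x, g x ∂(m a : Measure X)) l (𝓝 0) := by
  -- for `η > 0` there is a constant `C` with `|g| ≤ η + C V`
  have key : ∀ η > 0, ∃ C : ℝ, ∀ x, |g x| ≤ η + C * V x := by
    intro η hη
    have hK : IsCompact {x | η ≤ |g x|} :=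
      (isClosed_le continuous_const g.continuous.abs).isCompact
    obtain hE | hne := {x | η ≤ |g x|}.eq_empty_or_nonempty
    · refine ⟨0, fun x => ?_⟩
      have : x ∉ {x | η ≤ |g x|} := by rw [hE]; exact Set.notMem_empty x
      simpa using (not_le.1 this).le
    · obtain ⟨z, hz, hmin⟩ := hK.exists_isMinOn hne V.continuous.continuousOn
      have hVz : 0 < V z := by
        refine lt_of_le_of_ne (hV z) fun h => ?_
        have h1 : η ≤ |g z| := hz
        rw [hg z h.symm, abs_zero] at h1
        exact absurd h1 (not_le.2 hη)
      refine ⟨‖g‖ / V z, fun x => ?_⟩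
      obtain hx | hx := le_or_gt η |g x|
      · have h1 : V z ≤ V x := hmin hx
        have h2 : |g x| ≤ ‖g‖ := g.norm_coe_le_norm x
        have h3 : ‖g‖ ≤ ‖g‖ / V z * V x := by
          rw [div_mul_eq_mul_div, le_div_iff₀ hVz]
          exact mul_le_mul_of_nonneg_left h1 (norm_nonneg g)
        linarith
      · have : 0 ≤ ‖g‖ / V z * V x := mul_nonneg (by positivity) (hV x)
        linarith
  rw [Metric.tendsto_nhds]
  intro η hη
  obtain ⟨C, hC⟩ := key (η / 2) (half_pos hη)
  have h1 : Tendsto (fun a => η / 2 + C * ∫ x, V x ∂(m a : Measure X)) l (𝓝 (η / 2)) := by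
    simpa using (hm.const_mul C).const_add (η / 2)
  filter_upwards [h1.eventually_lt_const (half_lt_self hη)] with a ha
  rw [dist_zero_right]
  refine lt_of_le_of_lt ?_ ha
  have hVi := ProbabilityTheory.Kernel.integrable_continuousMap (m a : Measure X) V
  calc ‖∫ x, g x ∂(m a : Measure X)‖
      ≤ ∫ x, (η / 2 + C * V x) ∂(m a : Measure X) :=
        norm_integral_le_of_norm_le ((integrable_const _).add (hVi.const_mul C))
          (Eventually.of_forall hC)
    _ = η / 2 + C * ∫ x, V x ∂(m a : Measure X) := by
        rw [integral_add (integrable_const _) (hVi.const_mul C), integral_const_mul]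
        simp

/-! ### Stationary vectors of finite Markov chains -/

namespace Matrix

variable {S : Type*} [Fintype S] {M : Matrix S S ℝ}

/-- The zero set of a nonnegative stationary vector is closed under passing to predecessors, so in
an irreducible chain a nonnegative stationary vector with a zero entry vanishes. -/
theorem eq_zero_of_vecMul_eq_self_of_exists_eq_zero (hM : ∀ s s', 0 ≤ M s s')
    (hconn : ∀ Z : Set S, Z.Nonempty → (∀ s, ∀ s' ∈ Z, 0 < M s s' → s ∈ Z) → Z = Set.univ)
    {y : S → ℝ} (hy : ∀ s, 0 ≤ y s) (hfix : vecMul y M = y) (h0 : ∃ s, y s = 0) : y = 0 := by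
  have hZ := hconn {s | y s = 0} h0 fun s s' (hs' : y s' = 0) hpos => by
    have h1 : ∑ k, y k * M k s' = 0 := by
      rw [← hs']; exact congrFun hfix s'
    have h2 := (Finset.sum_eq_zero_iff_of_nonneg
      (fun k _ => mul_nonneg (hy k) (hM k s'))).1 h1 s (Finset.mem_univ s)
    exact (mul_eq_zero.1 h2).resolve_right hpos.ne'
  funext s
  have : s ∈ {s | y s = 0} := by rw [hZ]; exact Set.mem_univ s
  exact this

/-- An irreducible chain has at most one stationary probability vector. -/
theorem stdSimplex_eq_of_vecMul_eq_self (hM : ∀ s s', 0 ≤ M s s')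
    (hconn : ∀ Z : Set S, Z.Nonempty → (∀ s, ∀ s' ∈ Z, 0 < M s s' → s ∈ Z) → Z = Set.univ)
    {x y : stdSimplex ℝ S} (hx : vecMul x.1 M = x.1) (hy : vecMul y.1 M = y.1) : x = y := by
  have hypos : ∀ s, 0 < y.1 s := by
    by_contra! h
    obtain ⟨s, hs⟩ := h
    have h0 := eq_zero_of_vecMul_eq_self_of_exists_eq_zero hM hconn y.2.1 hy
      ⟨s, le_antisymm hs (y.2.1 s)⟩
    have h1 := y.2.2
    simp [h0] at h1
  have hne : Nonempty S := by
    by_contra! h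
    simpa using x.2.2
  -- subtract the largest multiple of `y` that keeps `x` nonnegative
  obtain ⟨s₀, hs₀⟩ := Finite.exists_min fun s => x.1 s / y.1 s
  set a := x.1 s₀ / y.1 s₀ with ha
  have hz : x.1 - a • y.1 = 0 := by
    refine eq_zero_of_vecMul_eq_self_of_exists_eq_zero hM hconn (fun s => ?_) ?_ ⟨s₀, ?_⟩
    · have := (le_div_iff₀ (hypos s)).1 (hs₀ s)
      simpa using this
    · rw [sub_vecMul, smul_vecMul, hx, hy]
    · have := (hypos s₀).ne'
      simp [ha, this]
  have hxy : ∀ s, x.1 s = a * y.1 s := fun s => by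
    simpa [sub_eq_zero] using congrFun hz s
  have ha1 : a = 1 := by
    have h1 := x.2.2
    simp_rw [hxy, ← Finset.mul_sum, y.2.2, mul_one] at h1
    exact h1
  refine Subtype.ext (funext fun s => ?_)
  rw [hxy, ha1, one_mul]

theorem vecMul_eq_self_of_mapClusterPt {Λ : Type*} {l : Filter Λ} {p : Λ → stdSimplex ℝ S}
    (hp : ∀ s, Tendsto (fun a => vecMul (p a).1 M s - (p a).1 s) l (𝓝 0))
    {π : stdSimplex ℝ S} (hπ : MapClusterPt π l p) : vecMul π.1 M = π.1 := by
  funext s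
  have hc : Continuous fun q : stdSimplex ℝ S => vecMul q.1 M s - q.1 s := by
    have hs : ∀ k, Continuous fun q : stdSimplex ℝ S => q.1 k := fun k =>
      (continuous_apply k).comp continuous_subtype_val
    exact (continuous_finsetSum _ fun k _ => (hs k).mul continuous_const).sub (hs s)
  have h1 : MapClusterPt (vecMul π.1 M s - π.1 s) l fun a => vecMul (p a).1 M s - (p a).1 s :=
    hπ.continuousAt_comp hc.continuousAt
  exact sub_eq_zero.1 (eq_of_nhds_neBot (ClusterPt.mono h1 (hp s)))

/-- Probability vectors that are asymptotically stationary for an irreducible chain converge to its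
stationary vector, which therefore exists. -/
theorem exists_tendsto_stdSimplex (hM : ∀ s s', 0 ≤ M s s')
    (hconn : ∀ Z : Set S, Z.Nonempty → (∀ s, ∀ s' ∈ Z, 0 < M s s' → s ∈ Z) → Z = Set.univ)
    {Λ : Type*} {l : Filter Λ} [l.NeBot] {p : Λ → stdSimplex ℝ S}
    (hp : ∀ s, Tendsto (fun a => vecMul (p a).1 M s - (p a).1 s) l (𝓝 0)) :
    ∃ π : stdSimplex ℝ S, vecMul π.1 M = π.1 ∧ Tendsto p l (𝓝 π) := by
  obtain ⟨π, hπ⟩ : ∃ π, MapClusterPt π l p := exists_clusterPt_of_compactSpace _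
  have hfix := vecMul_eq_self_of_mapClusterPt hp hπ
  exact ⟨π, hfix, tendsto_nhds_of_unique_mapClusterPt fun q hq =>
    stdSimplex_eq_of_vecMul_eq_self hM hconn (vecMul_eq_self_of_mapClusterPt hp hq) hfix⟩

end Matrix

/-! ### The one-step kernels -/

namespace AspirationLearning

variable {ι : Type u} {A : ι → Type v}

section Response

variable (L : AspirationLearning ι A)

theorem response_le_one (z : ℝ) : L.response z ≤ 1 := by
  unfold response
  split_ifs with hz
  · exact le_rfl
  · exact max_le L.h_lt_one.le (by nlinarith [L.c_pos])

theorem response_pos (z : ℝ) : 0 < L.response z := by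
  unfold response
  split_ifs
  · exact one_pos
  · exact L.h_pos.trans_le (le_max_left _ _)

theorem response_lt_one {z : ℝ} (hz : z < 0) : L.response z < 1 := by
  rw [response, if_neg (not_le.2 hz)]
  exact max_lt L.h_lt_one (by nlinarith [L.c_pos])

theorem continuous_response : Continuous L.response := by
  unfold response
  refine Continuous.if_le continuous_const (by fun_prop) continuous_const continuous_id ?_
  rintro x rfl
  simp [L.h_lt_one.le]

/-- The response is at least `exp (-(c / h) |z|)`, because `log m ≥ 1 - 1 / m` for `m = φ z`. -/
theorem exp_le_response (z : ℝ) : Real.exp (-(L.c / L.h * |z|)) ≤ L.response z := by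
  unfold response
  have hc := L.c_pos
  have hh := L.h_pos
  split_ifs with hz
  · rw [Real.exp_le_one_iff]
    have : 0 ≤ L.c / L.h * |z| := by positivity
    linarith
  · set m := max L.h (1 + L.c * z) with hm
    have hm1 : L.h ≤ m := le_max_left _ _
    have hm2 : 1 + L.c * z ≤ m := le_max_right _ _
    have hm0 : 0 < m := hh.trans_le hm1
    rw [← Real.le_log_iff_exp_le hm0, abs_of_neg (not_le.1 hz)]
    refine le_trans ?_ (Real.one_sub_inv_le_log_of_pos hm0)
    have hcz : 0 ≤ L.c * -z := mul_nonneg hc.le (by linarith)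
    have h1 : L.c * -z / m ≤ L.c * -z / L.h := div_le_div_of_nonneg_left hcz hh hm1
    have h2 : m⁻¹ - 1 ≤ L.c * -z / m := by
      rw [le_div_iff₀ hm0, sub_mul, inv_mul_cancel₀ hm0.ne']
      linarith
    have h3 : L.c / L.h * -z = L.c * -z / L.h := by ring
    linarith

end Response

variable [Fintype ι] [DecidableEq ι]
  [∀ i, Fintype (A i)] [∀ i, DecidableEq (A i)]
  [∀ i, TopologicalSpace (A i)] [∀ i, DiscreteTopology (A i)]
  [∀ i, MeasurableSpace (A i)] [∀ i, BorelSpace (A i)]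

section ActionProb

variable (L : AspirationLearning ι A)

theorem one_le_card_sub_one {i : ι} {a b : A i} (hab : b ≠ a) :
    (1 : ℝ) ≤ (Fintype.card (A i) : ℝ) - 1 := by
  have h : 1 < Fintype.card (A i) := Fintype.one_lt_card_iff.2 ⟨b, a, hab⟩
  have : (2 : ℝ) ≤ Fintype.card (A i) := by exact_mod_cast h
  linarith

theorem actionProb_nonneg (x : L.State) (i : ι) (b : A i) : 0 ≤ L.actionProb x i b := by
  unfold actionProb
  split_ifs with hb hc
  · exact zero_le_one
  · exact (L.response_pos _).le
  · exact div_nonneg (by linarith [L.response_le_one (L.u i x.1 - x.2 i)])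
      (by linarith [one_le_card_sub_one hb])

theorem response_le_actionProb (x : L.State) (i : ι) :
    L.response (L.u i x.1 - x.2 i) ≤ L.actionProb x i (x.1 i) := by
  rw [actionProb, if_pos rfl]
  split_ifs
  · exact L.response_le_one _
  · exact le_rfl

theorem actionProb_pos_of_ne {x : L.State} {i : ι} {b : A i} (hb : b ≠ x.1 i)
    (hx : L.u i x.1 < x.2 i) : 0 < L.actionProb x i b := by
  rw [actionProb, if_neg hb]
  exact div_pos (by linarith [L.response_lt_one (sub_neg.2 hx)])
    (by linarith [one_le_card_sub_one hb])

theorem sum_actionProb (x : L.State) (i : ι) : ∑ b, L.actionProb x i b = 1 := by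
  rw [← Finset.add_sum_erase _ _ (Finset.mem_univ (x.1 i))]
  have h : ∀ b ∈ Finset.univ.erase (x.1 i), L.actionProb x i b =
      (1 - L.response (L.u i x.1 - x.2 i)) / ((Fintype.card (A i) : ℝ) - 1) := fun b hb => by
    rw [actionProb, if_neg (Finset.ne_of_mem_erase hb)]
  have hcard : 1 ≤ Fintype.card (A i) := Fintype.card_pos_iff.2 ⟨x.1 i⟩
  rw [Finset.sum_congr rfl h, Finset.sum_const, Finset.card_erase_of_mem (Finset.mem_univ _),
    Finset.card_univ, actionProb, if_pos rfl, nsmul_eq_mul, Nat.cast_sub hcard, Nat.cast_one]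
  split_ifs with h1
  · simp [h1]
  · have h2 : (Fintype.card (A i) : ℝ) - 1 ≠ 0 := by
      rw [sub_ne_zero]; exact_mod_cast h1
    rw [mul_div_cancel₀ _ h2]
    ring

/-- The probability that the next action profile is `b`. -/
noncomputable def profileProb (x : L.State) (b : ∀ i, A i) : ℝ :=
  ∏ i, L.actionProb x i (b i)

theorem profileProb_nonneg (x : L.State) (b : ∀ i, A i) : 0 ≤ L.profileProb x b :=
  Finset.prod_nonneg fun i _ => L.actionProb_nonneg x i (b i)

theorem sum_profileProb (x : L.State) : ∑ b, L.profileProb x b = 1 := by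
  simp only [profileProb]
  rw [← Fintype.prod_sum]
  simp [sum_actionProb]

theorem continuous_discontent (i : ι) :
    Continuous fun x : L.State => L.u i x.1 - (x.2 i : ℝ) := by
  have h : Continuous (L.u i) := continuous_of_discreteTopology
  fun_prop

theorem continuous_profileProb (b : ∀ i, A i) :
    Continuous fun x : L.State => L.profileProb x b := by
  refine continuous_finsetProd _ fun i _ => ?_
  have h := L.continuous_response.comp (L.continuous_discontent i)
  have hb : IsClopen {x : L.State | b i = x.1 i} :=
    (isClopen_discrete {a : ∀ i, A i | b i = a i}).preimage continuous_fst
  unfold actionProb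
  refine Continuous.if (fun x hx => ?_) ?_ ((continuous_const.sub h).div_const _)
  · have hfr : frontier {x : L.State | b i = x.1 i} = ∅ := hb.frontier_eq
    exact absurd (hfr ▸ hx) (Set.notMem_empty x)
  · split_ifs
    · exact continuous_const
    · exact h

instance isMarkovKernel_actionKernel : IsMarkovKernel L.actionKernel := ⟨fun x => ⟨by
  change (∑ b : ∀ i, A i, ENNReal.ofReal (L.profileProb x b) • Measure.dirac b) Set.univ = 1
  simp only [Measure.coe_finsetSum, Measure.coe_smul, Finset.sum_apply, Pi.smul_apply,
    measure_univ, smul_eq_mul, mul_one]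
  rw [← ENNReal.ofReal_sum_of_nonneg fun b _ => L.profileProb_nonneg x b, L.sum_profileProb,
    ENNReal.ofReal_one]⟩⟩

end ActionProb

variable [Nonempty ι] [∀ i, Nonempty (A i)]

section Step

variable (L : AspirationLearning ι A)

theorem continuous_nextAspiration : Continuous L.nextAspiration := by
  refine continuous_pi fun i => ?_
  have h : Continuous (L.u i) := continuous_of_discreteTopology
  unfold nextAspiration
  refine continuous_projIcc.comp ?_
  fun_prop

instance isMarkovKernel_stepKernel (ν : Measure (ι → ℝ)) [IsProbabilityMeasure ν] :
    IsMarkovKernel (L.stepKernel ν) := by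
  have := Kernel.IsMarkovKernel.map (Kernel.id ×ₖ Kernel.const L.State ν)
    L.measurable_nextAspiration
  unfold stepKernel
  infer_instance

/-- One step as an average over the new profile and the tremble. -/
theorem integral_stepKernel (ν : Measure (ι → ℝ)) [IsProbabilityMeasure ν] (f : C(L.State, ℝ))
    (x : L.State) :
    ∫ y, f y ∂L.stepKernel ν x =
      ∑ b, L.profileProb x b * ∫ r, f (b, L.nextAspiration (x, r)) ∂ν := by
  have hnext : Measurable fun r => L.nextAspiration (x, r) :=
    L.measurable_nextAspiration.comp measurable_prodMk_left
  have hasp : ((Kernel.id ×ₖ Kernel.const L.State ν).map L.nextAspiration) x =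
      ν.map fun r => L.nextAspiration (x, r) := by
    rw [Kernel.map_apply _ L.measurable_nextAspiration, Kernel.prod_apply, Kernel.id_apply,
      Kernel.const_apply, Measure.dirac_prod, Measure.map_map L.measurable_nextAspiration
      measurable_prodMk_left]
    rfl
  have := Kernel.IsMarkovKernel.map (Kernel.id ×ₖ Kernel.const L.State ν)
    L.measurable_nextAspiration
  have hstep : L.stepKernel ν x =
      (L.actionKernel x).prod (ν.map fun r => L.nextAspiration (x, r)) := by
    rw [stepKernel, Kernel.prod_apply, hasp]
  have hprob : IsProbabilityMeasure (ν.map fun r => L.nextAspiration (x, r)) :=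
    Measure.isProbabilityMeasure_map hnext.aemeasurable
  have hact : L.actionKernel x =
      ∑ b : ∀ i, A i, ENNReal.ofReal (L.profileProb x b) • Measure.dirac b := rfl
  have hint := Kernel.integrable_continuousMap (L.stepKernel ν x) f
  rw [hstep] at hint ⊢
  rw [integral_prod _ hint, hact, integral_finsetSum_measure fun b _ =>
    Integrable.smul_measure (.of_finite (μ := Measure.dirac b)) ENNReal.ofReal_ne_top]
  refine Finset.sum_congr rfl fun b _ => ?_
  rw [integral_smul_measure, integral_dirac, ENNReal.toReal_ofReal (L.profileProb_nonneg x b),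
    smul_eq_mul, integral_map hnext.aemeasurable]
  exact (f.continuous.comp (Continuous.prodMk_right b)).aestronglyMeasurable

theorem isFeller_stepKernel (ν : Measure (ι → ℝ)) [IsProbabilityMeasure ν] :
    (L.stepKernel ν).IsFeller := by
  intro f
  simp_rw [integral_stepKernel]
  refine continuous_finsetSum _ fun b _ => (L.continuous_profileProb b).mul ?_
  refine continuous_of_dominated (bound := fun _ => ‖f‖) (fun x => ?_)
    (fun x => Eventually.of_forall fun r => f.norm_coe_le_norm _) (integrable_const _)
    (Eventually.of_forall fun r => ?_)
  · have := L.continuous_nextAspiration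
    exact Continuous.aestronglyMeasurable (by fun_prop)
  · have := L.continuous_nextAspiration
    fun_prop

/-- The Markov operator of one step with tremble law `ν`. -/
noncomputable def stepOp (ν : Measure (ι → ℝ)) [IsProbabilityMeasure ν] :
    C(L.State, ℝ) →L[ℝ] C(L.State, ℝ) :=
  (L.stepKernel ν).fellerOp (L.isFeller_stepKernel ν)

theorem stepOp_apply (ν : Measure (ι → ℝ)) [IsProbabilityMeasure ν] (f : C(L.State, ℝ))
    (x : L.State) :
    L.stepOp ν f x = ∑ b, L.profileProb x b * ∫ r, f (b, L.nextAspiration (x, r)) ∂ν :=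
  L.integral_stepKernel ν f x

end Step

/-! ### Expansion in the set of trembling agents -/

section Trembles

variable (L : AspirationLearning ι A)

instance isProbabilityMeasure_uniformTremble : IsProbabilityMeasure L.uniformTremble := by
  refine cond_isProbabilityMeasure_of_finite ?_ ?_
  · simp [L.ζ_pos]
  · simp

/-- The tremble law when exactly the agents in `S` tremble. -/
noncomputable def setTremble (S : Finset ι) : Measure (ι → ℝ) :=
  Measure.pi fun j => if j ∈ S then L.uniformTremble else Measure.dirac 0

instance isProbabilityMeasure_ite (p : Prop) [Decidable p] :
    IsProbabilityMeasure (if p then L.uniformTremble else Measure.dirac 0) := by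
  split_ifs <;> infer_instance

instance isProbabilityMeasure_setTremble (S : Finset ι) :
    IsProbabilityMeasure (L.setTremble S) := by
  unfold setTremble; infer_instance

theorem isProbabilityMeasure_trembleLaw {lam : ℝ} (hlam : lam ∈ Set.Icc (0 : ℝ) 1) :
    IsProbabilityMeasure (L.trembleLaw lam) := ⟨by
  simp only [trembleLaw, Measure.coe_add, Measure.coe_smul, Pi.add_apply, Pi.smul_apply,
    measure_univ, smul_eq_mul, mul_one]
  rw [← ENNReal.ofReal_add (by linarith [hlam.2]) hlam.1]
  simp⟩

theorem isProbabilityMeasure_trembles {lam : ℝ} (hlam : lam ∈ Set.Icc (0 : ℝ) 1) :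
    IsProbabilityMeasure (L.trembles lam) := by
  have := L.isProbabilityMeasure_trembleLaw hlam
  unfold trembles; infer_instance

/-- The probability that exactly the agents in `S` tremble. -/
noncomputable def trembleWeight (lam : ℝ) (S : Finset ι) : ℝ :=
  lam ^ S.card * (1 - lam) ^ (Fintype.card ι - S.card)

theorem trembleWeight_nonneg {lam : ℝ} (hlam : lam ∈ Set.Icc (0 : ℝ) 1) (S : Finset ι) :
    0 ≤ trembleWeight lam S :=
  mul_nonneg (pow_nonneg hlam.1 _) (pow_nonneg (by linarith [hlam.2]) _)

theorem sum_trembleWeight (lam : ℝ) : ∑ S : Finset ι, trembleWeight lam S = 1 := by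
  simp only [trembleWeight]
  rw [Fintype.sum_pow_mul_eq_add_pow]
  simp

theorem trembles_eq_sum {lam : ℝ} (hlam : lam ∈ Set.Icc (0 : ℝ) 1) :
    L.trembles lam =
      ∑ S : Finset ι, ENNReal.ofReal (trembleWeight lam S) • L.setTremble S := by
  have := L.isProbabilityMeasure_trembleLaw hlam
  refine Measure.pi_eq fun s hs => ?_
  have h1 : ∀ i, L.trembleLaw lam (s i) = ENNReal.ofReal lam * L.uniformTremble (s i) +
      ENNReal.ofReal (1 - lam) * (Measure.dirac 0 : Measure ℝ) (s i) := fun i => by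
    simp only [trembleLaw, Measure.coe_add, Measure.coe_smul, Pi.add_apply, Pi.smul_apply,
      smul_eq_mul]
    exact add_comm _ _
  simp_rw [h1]
  rw [Finset.prod_add, Finset.powerset_univ]
  simp only [Measure.coe_finsetSum, Measure.coe_smul, Finset.sum_apply, Pi.smul_apply, smul_eq_mul]
  refine Finset.sum_congr rfl fun S _ => ?_
  rw [setTremble, Measure.pi_pi, Finset.prod_mul_distrib, Finset.prod_mul_distrib,
    Finset.prod_const, Finset.prod_const, ← Finset.prod_mul_prod_compl S,
    ← Finset.compl_eq_univ_sdiff, Finset.card_compl, trembleWeight,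
    ENNReal.ofReal_mul (pow_nonneg hlam.1 _), ENNReal.ofReal_pow hlam.1,
    ENNReal.ofReal_pow (by linarith [hlam.2])]
  have h2 : ∏ i ∈ S, (if i ∈ S then L.uniformTremble else Measure.dirac 0) (s i) =
      ∏ i ∈ S, L.uniformTremble (s i) :=
    Finset.prod_congr rfl fun i hi => by rw [if_pos hi]
  have h3 : ∏ i ∈ Sᶜ, (if i ∈ S then L.uniformTremble else Measure.dirac 0) (s i) =
      ∏ i ∈ Sᶜ, (Measure.dirac 0 : Measure ℝ) (s i) :=
    Finset.prod_congr rfl fun i hi => by rw [if_neg (Finset.mem_compl.1 hi)]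
  rw [h2, h3]
  ring

theorem trembles_zero : L.trembles 0 = L.setTremble ∅ := by
  simp [trembles, setTremble, trembleLaw]

theorem setTremble_empty : L.setTremble ∅ = Measure.dirac 0 := by
  simp only [setTremble, Finset.notMem_empty, if_false]
  exact Measure.pi_eq fun s hs => by
    rw [Measure.dirac_apply' _ (MeasurableSet.univ_pi hs)]
    simp_rw [Measure.dirac_apply' _ (hs _)]
    by_cases h : ∀ i, (0 : ℝ) ∈ s i
    · simp [h]
    · rw [Set.indicator_of_notMem (by simpa using h)]
      obtain ⟨i, hi⟩ := not_forall.1 h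
      exact (Finset.prod_eq_zero (Finset.mem_univ i) (Set.indicator_of_notMem hi _)).symm

theorem singleTremble_eq_sum :
    L.singleTremble =
      ENNReal.ofReal (1 / (Fintype.card ι : ℝ)) • ∑ i : ι, L.setTremble {i} := by
  simp [singleTremble, setTremble]

instance isProbabilityMeasure_singleTremble : IsProbabilityMeasure L.singleTremble := ⟨by
  have hn : (0 : ℝ) < Fintype.card ι := by exact_mod_cast Fintype.card_pos
  rw [singleTremble_eq_sum]
  simp only [Measure.coe_smul, Measure.coe_finsetSum, Pi.smul_apply, Finset.sum_apply,
    measure_univ, Finset.sum_const, Finset.card_univ, nsmul_eq_mul, mul_one, smul_eq_mul]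
  rw [← ENNReal.ofReal_natCast, ← ENNReal.ofReal_mul (by positivity), one_div,
    inv_mul_cancel₀ hn.ne', ENNReal.ofReal_one]⟩

theorem stepOp_eq_sum_of_eq_sum {J : Type*} [Fintype J] (ν : Measure (ι → ℝ))
    [IsProbabilityMeasure ν] (w : J → ℝ) (hw : ∀ j, 0 ≤ w j) (m : J → Measure (ι → ℝ))
    [∀ j, IsProbabilityMeasure (m j)] (hν : ν = ∑ j, ENNReal.ofReal (w j) • m j)
    (f : C(L.State, ℝ)) (x : L.State) :
    L.stepOp ν f x = ∑ j, w j * L.stepOp (m j) f x := by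
  have hint : ∀ (m' : Measure (ι → ℝ)) [IsFiniteMeasure m'] (b : ∀ i, A i),
      Integrable (fun r => f (b, L.nextAspiration (x, r))) m' := fun m' _ b => by
    have := L.continuous_nextAspiration
    exact .of_bound (Continuous.aestronglyMeasurable (by fun_prop)) ‖f‖
      (Eventually.of_forall fun r => f.norm_coe_le_norm _)
  simp only [stepOp_apply, Finset.mul_sum]
  rw [Finset.sum_comm]
  refine Finset.sum_congr rfl fun b _ => ?_
  rw [hν, integral_finsetSum_measure fun j _ =>
    (hint (m j) b).smul_measure ENNReal.ofReal_ne_top, Finset.mul_sum]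
  refine Finset.sum_congr rfl fun j _ => ?_
  rw [integral_smul_measure, ENNReal.toReal_ofReal (hw j), smul_eq_mul]
  ring

theorem stepOp_singleTremble_apply (f : C(L.State, ℝ)) (x : L.State) :
    L.stepOp L.singleTremble f x =
      1 / (Fintype.card ι : ℝ) * ∑ i, L.stepOp (L.setTremble {i}) f x := by
  rw [L.stepOp_eq_sum_of_eq_sum L.singleTremble (fun _ : ι => 1 / (Fintype.card ι : ℝ))
    (fun _ => by positivity) (fun i => L.setTremble {i})
    (by rw [singleTremble_eq_sum, Finset.smul_sum]), Finset.mul_sum]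

end Trembles

end AspirationLearning

/-! ### Drift of the unperturbed chain towards the pure states -/

namespace AspirationLearning

variable {ι : Type u} {A : ι → Type v} [Fintype ι] [DecidableEq ι]
  [∀ i, Fintype (A i)] [∀ i, DecidableEq (A i)]
  [∀ i, TopologicalSpace (A i)] [∀ i, DiscreteTopology (A i)]
  [∀ i, MeasurableSpace (A i)] [∀ i, BorelSpace (A i)]

section Lyapunov

variable (L : AspirationLearning ι A)

/-- The total distance between aspiration levels and current payoffs. -/
noncomputable def discrepancy : C(L.State, ℝ) where
  toFun x := ∑ i, |L.u i x.1 - (x.2 i : ℝ)|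
  continuous_toFun := continuous_finsetSum _ fun i _ => (L.continuous_discontent i).abs

theorem discrepancy_apply (x : L.State) :
    L.discrepancy x = ∑ i, |L.u i x.1 - (x.2 i : ℝ)| := rfl

theorem discrepancy_nonneg (x : L.State) : 0 ≤ L.discrepancy x :=
  Finset.sum_nonneg fun _ _ => abs_nonneg _

theorem discrepancy_eq_zero_iff {x : L.State} :
    L.discrepancy x = 0 ↔ ∀ i, L.u i x.1 = x.2 i := by
  rw [discrepancy_apply, Finset.sum_eq_zero_iff_of_nonneg fun _ _ => abs_nonneg _]
  simp [sub_eq_zero]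

theorem discrepancy_le (x : L.State) :
    L.discrepancy x ≤ Fintype.card ι * (L.hi - L.lo) := by
  rw [discrepancy_apply]
  have : ∀ i ∈ Finset.univ, |L.u i x.1 - (x.2 i : ℝ)| ≤ L.hi - L.lo := fun i _ => by
    have h1 := L.lo_lt i x.1
    have h2 := L.lt_hi i x.1
    have h3 := (x.2 i).2
    exact abs_le.2 ⟨by linarith [h3.2], by linarith [h3.1]⟩
  simpa [Finset.card_univ] using Finset.sum_le_card_nsmul _ _ _ this

/-- The contraction factor of the aspiration levels while the actions are frozen. -/
noncomputable def contraction : ℝ := |1 - L.ε|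

theorem contraction_nonneg : 0 ≤ L.contraction := abs_nonneg _

theorem contraction_lt_one : L.contraction < 1 :=
  abs_lt.2 ⟨by linarith [L.ε_lt_two], by linarith [L.ε_pos]⟩

/-- The profile stays frozen forever with probability at least `exp (-(decay * discrepancy))`;
the rate `decay` is the sum of the series `∑ t, (c / h) * contraction ^ t`. -/
noncomputable def decay : ℝ := L.c / L.h / (1 - L.contraction)

theorem decay_nonneg : 0 ≤ L.decay :=
  div_nonneg (div_nonneg L.c_pos.le L.h_pos.le) (by linarith [L.contraction_lt_one])

theorem decay_eq : L.c / L.h + L.decay * L.contraction = L.decay := by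
  have : 1 - L.contraction ≠ 0 := by linarith [L.contraction_lt_one]
  rw [decay]
  field_simp
  ring

/-- The maximum of the Lyapunov function; `Fintype.card ι * (L.hi - L.lo)` bounds the
discrepancy. -/
noncomputable def lyapunovBound : ℝ :=
  Fintype.card ι * (L.hi - L.lo) * Real.exp (L.decay * (Fintype.card ι * (L.hi - L.lo)))

/-- The Lyapunov function `V = d + B (1 - exp (-K d))` of the discrepancy `d`. The second term
bounds the expected discrepancy that is created when the actions change; `B` is chosen such that
`V ≤ B`. -/
noncomputable def lyapunov : C(L.State, ℝ) where
  toFun x := L.discrepancy x +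
    L.lyapunovBound * (1 - Real.exp (-(L.decay * L.discrepancy x)))
  continuous_toFun := by fun_prop

theorem lyapunov_apply (x : L.State) : L.lyapunov x = L.discrepancy x +
    L.lyapunovBound * (1 - Real.exp (-(L.decay * L.discrepancy x))) := rfl

theorem stay_ge (x : L.State) :
    Real.exp (-(L.c / L.h * L.discrepancy x)) ≤ L.profileProb x x.1 := by
  rw [discrepancy_apply, Finset.mul_sum, ← Finset.sum_neg_distrib, Real.exp_sum]
  exact Finset.prod_le_prod (fun _ _ => (Real.exp_pos _).le) fun i _ =>
    (L.exp_le_response _).trans (L.response_le_actionProb x i)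

theorem stay_pos (x : L.State) : 0 < L.profileProb x x.1 :=
  (Real.exp_pos _).trans_le (L.stay_ge x)

theorem stay_le_one (x : L.State) : L.profileProb x x.1 ≤ 1 := by
  rw [← L.sum_profileProb x]
  exact Finset.single_le_sum (fun b _ => L.profileProb_nonneg x b) (Finset.mem_univ _)

variable [Nonempty ι] [∀ i, Nonempty (A i)]

theorem range_nonneg : 0 ≤ (Fintype.card ι : ℝ) * (L.hi - L.lo) :=
  mul_nonneg (Nat.cast_nonneg _) (by linarith [L.lo_le_hi])

theorem lyapunovBound_nonneg : 0 ≤ L.lyapunovBound :=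
  mul_nonneg L.range_nonneg (Real.exp_pos _).le

theorem exp_neg_decay_le_one (x : L.State) :
    Real.exp (-(L.decay * L.discrepancy x)) ≤ 1 := by
  rw [Real.exp_le_one_iff]
  linarith [mul_nonneg L.decay_nonneg (L.discrepancy_nonneg x)]

theorem discrepancy_le_lyapunov (x : L.State) : L.discrepancy x ≤ L.lyapunov x := by
  have := mul_nonneg L.lyapunovBound_nonneg (sub_nonneg.2 (L.exp_neg_decay_le_one x))
  rw [lyapunov_apply]
  linarith

theorem lyapunov_nonneg (x : L.State) : 0 ≤ L.lyapunov x :=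
  (L.discrepancy_nonneg x).trans (L.discrepancy_le_lyapunov x)

theorem lyapunov_le_mul_discrepancy (x : L.State) :
    L.lyapunov x ≤ (1 + L.lyapunovBound * L.decay) * L.discrepancy x := by
  have h := Real.add_one_le_exp (-(L.decay * L.discrepancy x))
  have h2 : 1 - Real.exp (-(L.decay * L.discrepancy x)) ≤ L.decay * L.discrepancy x := by
    linarith
  have h3 := mul_le_mul_of_nonneg_left h2 L.lyapunovBound_nonneg
  rw [lyapunov_apply]
  linarith

theorem lyapunov_eq_zero_iff {x : L.State} :
    L.lyapunov x = 0 ↔ ∀ i, L.u i x.1 = x.2 i := by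
  rw [← discrepancy_eq_zero_iff]
  constructor
  · intro h
    exact le_antisymm (h ▸ L.discrepancy_le_lyapunov x) (L.discrepancy_nonneg x)
  · intro h
    have := L.lyapunov_le_mul_discrepancy x
    rw [h, mul_zero] at this
    exact le_antisymm this (L.lyapunov_nonneg x)

theorem lyapunov_le_bound (x : L.State) : L.lyapunov x ≤ L.lyapunovBound := by
  have h1 := L.discrepancy_le x
  set D : ℝ := Fintype.card ι * (L.hi - L.lo) with hD
  have h2 : Real.exp (-(L.decay * D)) ≤ Real.exp (-(L.decay * L.discrepancy x)) := by
    rw [Real.exp_le_exp]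
    linarith [mul_le_mul_of_nonneg_left h1 L.decay_nonneg]
  have h3 : L.lyapunovBound * Real.exp (-(L.decay * D)) = D := by
    rw [lyapunovBound, ← hD, mul_assoc, ← Real.exp_add, add_neg_cancel, Real.exp_zero, mul_one]
  have h4 := mul_le_mul_of_nonneg_left h2 L.lyapunovBound_nonneg
  rw [lyapunov_apply]
  linarith

end Lyapunov

variable [Nonempty ι] [∀ i, Nonempty (A i)]

section Unperturbed

variable (L : AspirationLearning ι A)

/-- The Markov operator of the unperturbed chain. -/
noncomputable def freeOp : C(L.State, ℝ) →L[ℝ] C(L.State, ℝ) := L.stepOp (L.setTremble ∅)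

/-- The successor of a state when no agent trembles and no agent changes its action. -/
noncomputable def freeze (x : L.State) : L.State := (x.1, L.nextAspiration (x, 0))

theorem freeOp_apply (f : C(L.State, ℝ)) (x : L.State) :
    L.freeOp f x = ∑ b, L.profileProb x b * f (b, L.nextAspiration (x, 0)) := by
  rw [freeOp, stepOp_apply]
  simp_rw [setTremble_empty]
  refine Finset.sum_congr rfl fun b _ => ?_
  have h : Measurable fun r => f (b, L.nextAspiration (x, r)) := by
    have := L.continuous_nextAspiration
    exact Continuous.measurable (by fun_prop)
  rw [integral_dirac' _ _ h.stronglyMeasurable]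

theorem discrepancy_freeze_le (x : L.State) :
    L.discrepancy (L.freeze x) ≤ L.contraction * L.discrepancy x := by
  rw [discrepancy_apply, discrepancy_apply, Finset.mul_sum]
  refine Finset.sum_le_sum fun i _ => ?_
  have hmem : L.u i x.1 ∈ Set.Icc L.lo L.hi := ⟨(L.lo_lt i x.1).le, (L.lt_hi i x.1).le⟩
  have h := Set.abs_projIcc_sub_projIcc (h := L.lo_le_hi) (c := L.u i x.1)
    (d := x.2 i + L.ε * (L.u i x.1 - x.2 i) + 0)
  rw [Set.projIcc_of_mem _ hmem] at h
  refine h.trans_eq ?_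
  rw [contraction, ← abs_mul]
  congr 1
  ring

theorem freeOp_le {f : C(L.State, ℝ)} {B : ℝ} (hf : ∀ y, f y ≤ B) (x : L.State) :
    L.freeOp f x ≤
      L.profileProb x x.1 * f (L.freeze x) + (1 - L.profileProb x x.1) * B := by
  rw [freeOp_apply, ← Finset.add_sum_erase _ _ (Finset.mem_univ x.1)]
  have h1 : 1 - L.profileProb x x.1 = ∑ b ∈ Finset.univ.erase x.1, L.profileProb x b := by
    rw [← L.sum_profileProb x, ← Finset.add_sum_erase _ _ (Finset.mem_univ x.1)]
    ring
  rw [h1, Finset.sum_mul]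
  exact add_le_add le_rfl (Finset.sum_le_sum fun b _ =>
    mul_le_mul_of_nonneg_left (hf _) (L.profileProb_nonneg x b))

theorem mul_le_freeOp {f : C(L.State, ℝ)} (hf : ∀ y, 0 ≤ f y) (x : L.State) (b : ∀ i, A i) :
    L.profileProb x b * f (b, L.nextAspiration (x, 0)) ≤ L.freeOp f x := by
  rw [freeOp_apply]
  exact Finset.single_le_sum
    (f := fun b => L.profileProb x b * f (b, L.nextAspiration (x, 0)))
    (fun b _ => mul_nonneg (L.profileProb_nonneg x b) (hf _)) (Finset.mem_univ b)

theorem exp_neg_decay_le_stay_mul (x : L.State) :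
    Real.exp (-(L.decay * L.discrepancy x)) ≤
      L.profileProb x x.1 * Real.exp (-(L.decay * L.discrepancy (L.freeze x))) := by
  have h1 : Real.exp (-(L.decay * (L.contraction * L.discrepancy x))) ≤
      Real.exp (-(L.decay * L.discrepancy (L.freeze x))) := by
    rw [Real.exp_le_exp]
    linarith [mul_le_mul_of_nonneg_left (L.discrepancy_freeze_le x) L.decay_nonneg]
  have h2 : -(L.decay * L.discrepancy x) = -(L.c / L.h * L.discrepancy x) +
      -(L.decay * (L.contraction * L.discrepancy x)) := by
    nth_rewrite 1 [← L.decay_eq]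
    ring
  rw [h2, Real.exp_add]
  exact mul_le_mul (L.stay_ge x) h1 (Real.exp_pos _).le (L.stay_pos x).le

theorem freeOp_lyapunov_le (x : L.State) :
    L.freeOp L.lyapunov x ≤ L.lyapunov x - (1 - L.contraction) * L.discrepancy x := by
  have h1 := L.freeOp_le L.lyapunov_le_bound x
  rw [L.lyapunov_apply (L.freeze x)] at h1
  have h2 := mul_le_mul_of_nonneg_left (L.exp_neg_decay_le_stay_mul x) L.lyapunovBound_nonneg
  have h3 : L.profileProb x x.1 * L.discrepancy (L.freeze x) ≤
      L.contraction * L.discrepancy x :=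
    (mul_le_of_le_one_left (L.discrepancy_nonneg _) (L.stay_le_one x)).trans
      (L.discrepancy_freeze_le x)
  rw [L.lyapunov_apply x]
  linarith

/-- The Lyapunov function is comparable with the discrepancy, so it decreases geometrically. -/
theorem exists_freeOp_lyapunov_le :
    ∃ r : ℝ, 0 ≤ r ∧ r < 1 ∧ ∀ x, L.freeOp L.lyapunov x ≤ r * L.lyapunov x := by
  set k := 1 + L.lyapunovBound * L.decay with hk
  have hk1 : 1 ≤ k := by
    linarith [mul_nonneg L.lyapunovBound_nonneg L.decay_nonneg]
  have hk0 : 0 < k := by linarith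
  have hq := L.contraction_lt_one
  have hq0 := L.contraction_nonneg
  refine ⟨1 - (1 - L.contraction) / k, ?_, ?_, fun x => ?_⟩
  · rw [sub_nonneg, div_le_one hk0]
    linarith
  · have : 0 < (1 - L.contraction) / k := div_pos (by linarith) hk0
    linarith
  · have h1 : (1 - L.contraction) / k * L.lyapunov x ≤
        (1 - L.contraction) * L.discrepancy x := by
      rw [div_mul_eq_mul_div, div_le_iff₀ hk0, mul_assoc]
      refine mul_le_mul_of_nonneg_left ?_ (by linarith)
      rw [mul_comm (L.discrepancy x)]
      exact L.lyapunov_le_mul_discrepancy x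
    linarith [L.freeOp_lyapunov_le x]

/-! ### Limit profiles of the unperturbed chain -/

/-- The indicator function of the action profile `a`, which is continuous. -/
noncomputable def profileInd (a : ∀ i, A i) : C(L.State, ℝ) where
  toFun x := if x.1 = a then 1 else 0
  continuous_toFun := by
    have h : Continuous fun b : ∀ i, A i => if b = a then (1 : ℝ) else 0 :=
      continuous_of_discreteTopology
    exact h.comp continuous_fst

theorem profileInd_apply (a : ∀ i, A i) (x : L.State) :
    L.profileInd a x = if x.1 = a then 1 else 0 := rfl

theorem profileInd_nonneg (a : ∀ i, A i) (x : L.State) : 0 ≤ L.profileInd a x := by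
  rw [profileInd_apply]; split_ifs <;> norm_num

theorem profileInd_le_one (a : ∀ i, A i) (x : L.State) : L.profileInd a x ≤ 1 := by
  rw [profileInd_apply]; split_ifs <;> norm_num

theorem abs_freeOp_profileInd_sub_le (a : ∀ i, A i) (x : L.State) :
    |L.freeOp (L.profileInd a) x - L.profileInd a x| ≤ L.c / L.h * L.lyapunov x := by
  have h0 : 1 - L.profileProb x x.1 ≤ L.c / L.h * L.lyapunov x := by
    have h1 := L.stay_ge x
    have h2 := Real.add_one_le_exp (-(L.c / L.h * L.discrepancy x))
    have h3 := mul_le_mul_of_nonneg_left (L.discrepancy_le_lyapunov x)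
      (div_pos L.c_pos L.h_pos).le
    linarith
  refine le_trans ?_ h0
  have h1 := L.freeOp_le (L.profileInd_le_one a) x
  have h2 : L.profileInd a (L.freeze x) = L.profileInd a x := rfl
  have h3 := L.mul_le_freeOp (L.profileInd_nonneg a) x x.1
  change L.profileProb x x.1 * L.profileInd a (L.freeze x) ≤ _ at h3
  rw [h2] at h1 h3
  have h4 := mul_nonneg (sub_nonneg.2 (L.stay_le_one x)) (L.profileInd_nonneg a x)
  have h5 := mul_le_mul_of_nonneg_left (L.profileInd_le_one a x) (sub_nonneg.2 (L.stay_le_one x))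
  exact abs_le.2 ⟨by linarith, by linarith⟩

theorem exists_limitProb (a : ∀ i, A i) :
    ∃ F : C(L.State, ℝ), Tendsto (fun t => (L.freeOp ^ t) (L.profileInd a)) atTop (𝓝 F) ∧
      L.freeOp F = F ∧ ∀ x, L.lyapunov x = 0 → F x = L.profileInd a x := by
  obtain ⟨r, hr0, hr1, hr⟩ := L.exists_freeOp_lyapunov_le
  exact Kernel.exists_harmonic_limit _ _ hr0 hr1 (div_pos L.c_pos L.h_pos).le hr
    (L.abs_freeOp_profileInd_sub_le a)

/-- The probability that the unperturbed chain eventually plays the profile `a` forever, as a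
function of the initial state. -/
noncomputable def limitProb (a : ∀ i, A i) : C(L.State, ℝ) := (L.exists_limitProb a).choose

theorem tendsto_limitProb (a : ∀ i, A i) :
    Tendsto (fun t => (L.freeOp ^ t) (L.profileInd a)) atTop (𝓝 (L.limitProb a)) :=
  (L.exists_limitProb a).choose_spec.1

theorem freeOp_limitProb (a : ∀ i, A i) : L.freeOp (L.limitProb a) = L.limitProb a :=
  (L.exists_limitProb a).choose_spec.2.1

theorem limitProb_of_lyapunov_eq_zero (a : ∀ i, A i) {x : L.State} (hx : L.lyapunov x = 0) :
    L.limitProb a x = L.profileInd a x :=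
  (L.exists_limitProb a).choose_spec.2.2 x hx

theorem tendsto_limitProb_apply (a : ∀ i, A i) (x : L.State) :
    Tendsto (fun t => (L.freeOp ^ t) (L.profileInd a) x) atTop (𝓝 (L.limitProb a x)) :=
  ((ContinuousEvalConst.continuous_eval_const x).tendsto _).comp (L.tendsto_limitProb a)

theorem limitProb_nonneg (a : ∀ i, A i) (x : L.State) : 0 ≤ L.limitProb a x :=
  ge_of_tendsto' (L.tendsto_limitProb_apply a x) fun t => by
    have h := Kernel.fellerOp_pow_mono _ (L.isFeller_stepKernel (L.setTremble ∅))
      (f := 0) (L.profileInd_nonneg a) t x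
    rw [map_zero] at h
    exact h

theorem limitProb_le_one (a : ∀ i, A i) (x : L.State) : L.limitProb a x ≤ 1 :=
  le_of_tendsto' (L.tendsto_limitProb_apply a x) fun t => by
    have h := Kernel.fellerOp_pow_mono _ (L.isFeller_stepKernel (L.setTremble ∅))
      (g := 1) (L.profileInd_le_one a) t x
    rw [Kernel.fellerOp_pow_one] at h
    exact h

theorem sum_profileInd : ∑ a, L.profileInd a = 1 := by
  ext x
  simp [profileInd_apply]

theorem sum_limitProb : ∑ a, L.limitProb a = 1 := by
  have h1 := tendsto_finsetSum Finset.univ fun a (_ : a ∈ Finset.univ) => L.tendsto_limitProb a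
  simp_rw [← map_sum, sum_profileInd] at h1
  have h2 : ∀ t, (L.freeOp ^ t) 1 = 1 := fun t => Kernel.fellerOp_pow_one _ _ t
  simp_rw [h2] at h1
  exact tendsto_nhds_unique h1 tendsto_const_nhds

/-- Every state can freeze forever: `exp (-K d)`, restricted to the states with profile `a`, is
subharmonic for the unperturbed chain. -/
theorem limitProb_pos_of_eq {a : ∀ i, A i} {x : L.State} (hx : x.1 = a) :
    0 < L.limitProb a x := by
  let e : C(L.State, ℝ) := ⟨fun y => Real.exp (-(L.decay * L.discrepancy y)), by fun_prop⟩
  let g : C(L.State, ℝ) := L.profileInd a * e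
  have hg0 : ∀ y, 0 ≤ g y := fun y => mul_nonneg (L.profileInd_nonneg a y) (Real.exp_pos _).le
  have hg1 : ∀ y, g y ≤ L.profileInd a y := fun y =>
    mul_le_of_le_one_right (L.profileInd_nonneg a y) (L.exp_neg_decay_le_one y)
  have hsub : ∀ y, g y ≤ L.freeOp g y := fun y => by
    refine le_trans ?_ (L.mul_le_freeOp hg0 y y.1)
    have h := mul_le_mul_of_nonneg_left (L.exp_neg_decay_le_stay_mul y)
      (L.profileInd_nonneg a y)
    exact h.trans_eq (mul_left_comm _ _ _)
  have hpow : ∀ t y, g y ≤ (L.freeOp ^ t) g y := by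
    intro t
    induction t with
    | zero => exact fun y => le_rfl
    | succ t ih =>
      intro y
      rw [pow_succ']
      exact (hsub y).trans (Kernel.fellerOp_mono _ _ ih y)
  have hgx : 0 < g x := by
    change 0 < L.profileInd a x * _
    rw [profileInd_apply, if_pos hx, one_mul]
    exact Real.exp_pos _
  refine hgx.trans_le (ge_of_tendsto' (L.tendsto_limitProb_apply a x) fun t => ?_)
  exact (hpow t x).trans
    (Kernel.fellerOp_pow_mono _ (L.isFeller_stepKernel (L.setTremble ∅)) hg1 t x)

/-- A dissatisfied agent may switch to any other action, and the new profile may then freeze. -/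
theorem limitProb_update_pos {x : L.State} {i : ι} {b : A i} (hb : b ≠ x.1 i)
    (hx : L.u i x.1 < x.2 i) : 0 < L.limitProb (Function.update x.1 i b) x := by
  rw [← L.freeOp_limitProb]
  refine lt_of_lt_of_le (mul_pos ?_ (L.limitProb_pos_of_eq rfl))
    (L.mul_le_freeOp (L.limitProb_nonneg _) x (Function.update x.1 i b))
  refine Finset.prod_pos fun j _ => ?_
  obtain rfl | hj := eq_or_ne j i
  · rw [Function.update_self]
    exact L.actionProb_pos_of_ne hb hx
  · rw [Function.update_of_ne hj]
    exact (L.response_pos _).trans_le (L.response_le_actionProb x j)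

/-- From a pure state, a single tremble can lead to every unilateral deviation: with positive
probability the tremble of agent `i` is positive and makes this agent dissatisfied. -/
theorem stepOp_singleTremble_limitProb_pos {x : L.State} (hx : ∀ i, L.u i x.1 = x.2 i)
    {i : ι} {b : A i} (hb : b ≠ x.1 i) :
    0 < L.stepOp L.singleTremble (L.limitProb (Function.update x.1 i b)) x := by
  set F := L.limitProb (Function.update x.1 i b) with hF
  have hF0 : ∀ y, 0 ≤ F y := L.limitProb_nonneg _
  have hn : (0 : ℝ) < Fintype.card ι := by exact_mod_cast Fintype.card_pos
  have hnn : ∀ j, 0 ≤ L.stepOp (L.setTremble {j}) F x := fun j => by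
    rw [stepOp_apply]
    exact Finset.sum_nonneg fun b _ =>
      mul_nonneg (L.profileProb_nonneg x b) (integral_nonneg fun r => hF0 _)
  rw [stepOp_singleTremble_apply]
  refine mul_pos (by positivity) (Finset.sum_pos' (fun j _ => hnn j) ⟨i, Finset.mem_univ i, ?_⟩)
  rw [stepOp_apply]
  refine Finset.sum_pos' (fun b _ =>
      mul_nonneg (L.profileProb_nonneg x b) (integral_nonneg fun r => hF0 _))
    ⟨x.1, Finset.mem_univ _, mul_pos (L.stay_pos x) ?_⟩
  have hcont : Continuous fun r => F (x.1, L.nextAspiration (x, r)) := by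
    have := L.continuous_nextAspiration
    fun_prop
  rw [integral_pos_iff_support_of_nonneg (fun r => hF0 _)
    (.of_bound hcont.aestronglyMeasurable ‖F‖
      (Eventually.of_forall fun r => F.norm_coe_le_norm _))]
  have hsub : (Function.eval i : (ι → ℝ) → ℝ) ⁻¹' Set.Ioi 0 ⊆
      Function.support fun r => F (x.1, L.nextAspiration (x, r)) := by
    intro r (hr : 0 < r i)
    refine (L.limitProb_update_pos (x := (x.1, L.nextAspiration (x, r))) hb ?_).ne'
    change L.u i x.1 < (Set.projIcc L.lo L.hi L.lo_le_hi
      (x.2 i + L.ε * (L.u i x.1 - x.2 i) + r i) : ℝ)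
    rw [Set.coe_projIcc, ← hx i]
    exact lt_max_of_lt_right (lt_min (L.lt_hi i x.1) (by linarith))
  refine lt_of_lt_of_le ?_ (measure_mono hsub)
  have hmp := measurePreserving_eval
    (fun j => if j ∈ ({i} : Finset ι) then L.uniformTremble else Measure.dirac 0) i
  rw [setTremble, hmp.measure_preimage measurableSet_Ioi.nullMeasurableSet,
    if_pos (Finset.mem_singleton_self i), uniformTremble, cond_apply measurableSet_Icc]
  have hI : Set.Ioc 0 L.ζ ⊆ Set.Icc (-L.ζ) L.ζ ∩ Set.Ioi 0 := fun z hz =>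
    ⟨⟨by linarith [hz.1, L.ζ_pos], hz.2⟩, hz.1⟩
  refine ENNReal.mul_pos (ENNReal.inv_ne_zero.2 (by simp)) (ne_of_gt ?_)
  refine lt_of_lt_of_le ?_ (measure_mono hI)
  simp [L.ζ_pos]

end Unperturbed

end AspirationLearning

/-! ### The tremble matrix -/

namespace AspirationLearning

variable {ι : Type u} {A : ι → Type v} [Fintype ι] [DecidableEq ι]
  [∀ i, Fintype (A i)] [∀ i, DecidableEq (A i)]
  [∀ i, TopologicalSpace (A i)] [∀ i, DiscreteTopology (A i)]
  [∀ i, MeasurableSpace (A i)] [∀ i, BorelSpace (A i)]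
  [Nonempty ι] [∀ i, Nonempty (A i)]

section Matrix

variable (L : AspirationLearning ι A)

/-- The pure state in which the profile `a` is played. -/
def pure (a : ∀ i, A i) : L.PureState :=
  ⟨(a, fun i => ⟨L.u i a, (L.lo_lt i a).le, (L.lt_hi i a).le⟩), fun _ => rfl⟩

theorem pure_profile (s : L.PureState) : L.pure s.1.1 = s :=
  Subtype.ext (Prod.ext rfl (funext fun i => Subtype.ext (s.2 i)))

/-- Pure states correspond to action profiles. -/
def pureEquiv : (∀ i, A i) ≃ L.PureState where
  toFun := L.pure
  invFun s := s.1.1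
  left_inv _ := rfl
  right_inv := L.pure_profile

theorem lyapunov_pureState (s : L.PureState) : L.lyapunov s.1 = 0 :=
  L.lyapunov_eq_zero_iff.2 s.2

/-- The transition matrix on the pure states: a single tremble, after which the unperturbed chain
is run until it settles. -/
noncomputable def trembleMatrix : Matrix L.PureState L.PureState ℝ :=
  fun s s' => L.stepOp L.singleTremble (L.limitProb s'.1.1) s.1

theorem trembleMatrix_nonneg (s s' : L.PureState) : 0 ≤ L.trembleMatrix s s' := by
  have h := Kernel.fellerOp_mono _ (L.isFeller_stepKernel L.singleTremble)
    (f := 0) (L.limitProb_nonneg s'.1.1) s.1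
  rw [map_zero] at h
  exact h

theorem sum_trembleMatrix (s : L.PureState) : ∑ s', L.trembleMatrix s s' = 1 := by
  rw [← L.pureEquiv.sum_comp]
  have h1 : L.stepOp L.singleTremble 1 = 1 := Kernel.fellerOp_one _ _
  rw [← sum_limitProb, map_sum] at h1
  have h2 := congrArg (fun f : C(L.State, ℝ) => f s.1) h1
  simp only [ContinuousMap.coe_sum, Finset.sum_apply, sum_limitProb] at h2
  exact h2

/-- The tremble matrix is irreducible, since it charges all unilateral deviations and any two
profiles are joined by unilateral deviations. -/
theorem trembleMatrix_irreducible (Z : Set L.PureState) (hne : Z.Nonempty)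
    (hZ : ∀ s, ∀ s' ∈ Z, 0 < L.trembleMatrix s s' → s ∈ Z) : Z = Set.univ := by
  have hupd : ∀ (a : ∀ i, A i) (i : ι) (b : A i), L.pure a ∈ Z →
      L.pure (Function.update a i b) ∈ Z := by
    intro a i b ha
    obtain hb | hb := eq_or_ne (a i) b
    · rwa [← hb, Function.update_eq_self]
    · refine hZ _ _ ha ?_
      have hne : a i ≠ (L.pure (Function.update a i b)).1.1 i := by
        change a i ≠ Function.update a i b i
        rwa [Function.update_self]
      have h := L.stepOp_singleTremble_limitProb_pos (L.pure (Function.update a i b)).2 hne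
      have hback : Function.update (L.pure (Function.update a i b)).1.1 i (a i) = a := by
        change Function.update (Function.update a i b) i (a i) = a
        rw [Function.update_idem, Function.update_eq_self]
      rw [hback] at h
      exact h
  obtain ⟨s, hs⟩ := hne
  refine Set.eq_univ_of_forall fun s' => ?_
  have hpw : ∀ T : Finset ι, L.pure (T.piecewise s'.1.1 s.1.1) ∈ Z := by
    intro T
    induction T using Finset.induction_on with
    | empty => rwa [Finset.piecewise_empty, pure_profile]
    | insert j T _ ih =>
      rw [Finset.piecewise_insert]
      exact hupd _ _ _ ih
  have h := hpw Finset.univ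
  rwa [Finset.piecewise_univ, pure_profile] at h

theorem kernel_zero : L.kernel 0 = L.stepKernel (L.setTremble ∅) := by
  rw [kernel, trembles_zero]

theorem measurableSet_nbhd (s : L.State) (δ : ℝ) : MeasurableSet (L.nbhd s δ) := by
  have h : L.nbhd s δ = {y : L.State | y.1 = s.1} ∩
      ⋂ i, {y : L.State | |(y.2 i : ℝ) - s.2 i| < δ} := by
    ext y; simp [nbhd]
  rw [h]
  refine IsOpen.measurableSet (IsOpen.inter ?_ (isOpen_iInter_of_finite fun i => ?_))
  · exact (isOpen_discrete {a : ∀ i, A i | a = s.1}).preimage continuous_fst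
  · exact isOpen_lt (by fun_prop) continuous_const

/-- The indicator functions of a profile and of a neighbourhood of its pure state differ only at
states of discrepancy at least `δ`. -/
theorem abs_real_nbhd_sub_integral_le (m : Measure L.State) [IsProbabilityMeasure m] {δ : ℝ}
    (hδ : 0 < δ) (s : L.PureState) :
    |m.real (L.nbhd s.1 δ) - ∫ y, L.profileInd s.1.1 y ∂m| ≤ 1 / δ * ∫ y, L.lyapunov y ∂m := by
  have hN := L.measurableSet_nbhd s.1 δ
  have hi : Integrable ((L.nbhd s.1 δ).indicator (1 : L.State → ℝ)) m :=
    (integrable_const (1 : ℝ)).indicator hN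
  have hsub := integral_sub hi (Kernel.integrable_continuousMap m (L.profileInd s.1.1))
  rw [← integral_indicator_one hN, ← integral_const_mul, ← hsub, ← Real.norm_eq_abs]
  refine norm_integral_le_of_norm_le
    ((Kernel.integrable_continuousMap m L.lyapunov).const_mul _) (Eventually.of_forall fun y => ?_)
  have h0 : 0 ≤ 1 / δ * L.lyapunov y := mul_nonneg (by positivity) (L.lyapunov_nonneg y)
  rw [profileInd_apply]
  by_cases hy : y ∈ L.nbhd s.1 δ
  · rw [Set.indicator_of_mem hy, if_pos hy.1]
    simpa using h0
  · rw [Set.indicator_of_notMem hy]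
    split_ifs with ha
    · have h1 : ∃ i, δ ≤ |(y.2 i : ℝ) - s.1.2 i| := by
        by_contra! h
        exact hy ⟨ha, h⟩
      obtain ⟨i, hi⟩ := h1
      have h2 : |L.u i y.1 - (y.2 i : ℝ)| ≤ L.discrepancy y :=
        Finset.single_le_sum (f := fun i => |L.u i y.1 - (y.2 i : ℝ)|)
          (fun _ _ => abs_nonneg _) (Finset.mem_univ i)
      rw [ha, s.2 i, abs_sub_comm] at h2
      have h3 := (hi.trans h2).trans (L.discrepancy_le_lyapunov y)
      have h4 : 1 ≤ 1 / δ * L.lyapunov y := by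
        rw [one_div, inv_mul_eq_div, one_le_div hδ]
        exact h3
      simpa using h4
    · simpa using h0

theorem isTrembleMatrix_trembleMatrix : L.IsTrembleMatrix L.trembleMatrix := by
  intro δ hδ s s'
  have hint : ∀ (t : ℕ) (f : C(L.State, ℝ)),
      ∫ y, f y ∂(((L.kernel 0) ^ t) ∘ₖ L.trembleKernel) s.1 =
      L.stepOp L.singleTremble ((L.freeOp ^ t) f) s.1 := by
    intro t f
    have : IsMarkovKernel L.trembleKernel := L.isMarkovKernel_stepKernel _
    rw [kernel_zero, Kernel.integral_comp (Kernel.integrable_continuousMap _ f)]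
    simp_rw [Kernel.integral_pow _ (L.isFeller_stepKernel (L.setTremble ∅))]
    rfl
  obtain ⟨r, hr0, hr1, hr⟩ := L.exists_freeOp_lyapunov_le
  have hV : Tendsto (fun t => L.stepOp L.singleTremble ((L.freeOp ^ t) L.lyapunov) s.1)
      atTop (𝓝 0) := by
    have hpow := (tendsto_pow_atTop_nhds_zero_of_lt_one hr0 hr1).mul_const
      (L.stepOp L.singleTremble L.lyapunov s.1)
    rw [zero_mul] at hpow
    refine squeeze_zero (fun t => ?_) (fun t => ?_) hpow
    · rw [← hint]
      exact integral_nonneg L.lyapunov_nonneg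
    · have h := Kernel.fellerOp_mono _ (L.isFeller_stepKernel L.singleTremble)
        (f := (L.freeOp ^ t) L.lyapunov) (g := r ^ t • L.lyapunov)
        (Kernel.fellerOp_pow_le _ _ hr0 hr t) s.1
      rw [map_smul] at h
      exact h
  have hF : Tendsto
      (fun t => L.stepOp L.singleTremble ((L.freeOp ^ t) (L.profileInd s'.1.1)) s.1)
      atTop (𝓝 (L.trembleMatrix s s')) :=
    ((ContinuousEvalConst.continuous_eval_const s.1).tendsto _).comp
      (((L.stepOp L.singleTremble).continuous.tendsto _).comp (L.tendsto_limitProb s'.1.1))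
  have hV' := hV.const_mul (1 / δ)
  rw [mul_zero] at hV'
  refine tendsto_of_tendsto_of_dist hF (squeeze_zero (fun _ => dist_nonneg) (fun t => ?_) hV')
  have : IsMarkovKernel L.trembleKernel := L.isMarkovKernel_stepKernel _
  have : IsMarkovKernel ((L.kernel 0) ^ t) := by
    rw [kernel_zero]; infer_instance
  rw [dist_comm, Real.dist_eq, ← hint, ← hint]
  exact L.abs_real_nbhd_sub_integral_le _ hδ s'

end Matrix

/-! ### Invariant measures for small tremble probability -/

section Invariant

variable (L : AspirationLearning ι A)

theorem exists_invariant_kernel {lam : ℝ} (hlam : lam ∈ Set.Icc (0 : ℝ) 1) :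
    ∃ m : ProbabilityMeasure L.State, (L.kernel lam).Invariant (m : Measure L.State) := by
  have := L.isProbabilityMeasure_trembles hlam
  have : Nonempty L.State := ⟨(L.pure (Classical.arbitrary _)).1⟩
  exact Kernel.exists_invariant_of_isFeller (κ := L.stepKernel (L.trembles lam))
    (L.isFeller_stepKernel _)

theorem integral_eq_sum_of_invariant {lam : ℝ} (hlam : lam ∈ Set.Icc (0 : ℝ) 1)
    {m : Measure L.State} [IsProbabilityMeasure m] (hm : (L.kernel lam).Invariant m)
    (f : C(L.State, ℝ)) :
    ∫ x, f x ∂m =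
      ∑ S : Finset ι, trembleWeight lam S * ∫ x, L.stepOp (L.setTremble S) f x ∂m := by
  have := L.isProbabilityMeasure_trembles hlam
  have h := Kernel.Invariant.integral_fellerOp (L.stepKernel (L.trembles lam))
    (L.isFeller_stepKernel _) hm f
  rw [← h]
  have h2 : ∀ x, Kernel.fellerOp _ (L.isFeller_stepKernel (L.trembles lam)) f x =
      ∑ S : Finset ι, trembleWeight lam S * L.stepOp (L.setTremble S) f x :=
    L.stepOp_eq_sum_of_eq_sum _ _ (trembleWeight_nonneg hlam) L.setTremble
      (L.trembles_eq_sum hlam) f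
  simp_rw [h2]
  rw [integral_finsetSum _ fun S _ => (Kernel.integrable_continuousMap m _).const_mul _]
  simp_rw [integral_const_mul]

theorem trembleWeight_empty (lam : ℝ) :
    trembleWeight lam (∅ : Finset ι) = (1 - lam) ^ Fintype.card ι := by
  simp [trembleWeight]

/-- Invariant measures concentrate near the pure states: the drift of the unperturbed chain acts
with probability `(1 - lam) ^ n`. -/
theorem integral_lyapunov_le_of_invariant {lam r : ℝ} (hlam : lam ∈ Set.Icc (0 : ℝ) 1)
    {m : Measure L.State} [IsProbabilityMeasure m] (hm : (L.kernel lam).Invariant m)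
    (hr0 : 0 ≤ r) (hr : ∀ x, L.freeOp L.lyapunov x ≤ r * L.lyapunov x) :
    (1 - r) * ∫ x, L.lyapunov x ∂m ≤ (1 - (1 - lam) ^ Fintype.card ι) * L.lyapunovBound := by
  have hsum := L.integral_eq_sum_of_invariant hlam hm L.lyapunov
  have hw := sum_trembleWeight (ι := ι) lam
  rw [← Finset.add_sum_erase _ _ (Finset.mem_univ ∅), trembleWeight_empty] at hsum hw
  have h1 : ∫ x, L.stepOp (L.setTremble ∅) L.lyapunov x ∂m ≤ r * ∫ x, L.lyapunov x ∂m := by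
    rw [← integral_const_mul]
    exact integral_mono (Kernel.integrable_continuousMap m _)
      ((Kernel.integrable_continuousMap m _).const_mul _) hr
  have h2 : ∀ S, ∫ x, L.stepOp (L.setTremble S) L.lyapunov x ∂m ≤ L.lyapunovBound := fun S => by
    have h3 : ∀ x, L.stepOp (L.setTremble S) L.lyapunov x ≤ L.lyapunovBound := fun x => by
      have h := integral_mono (μ := L.stepKernel (L.setTremble S) x)
        (Kernel.integrable_continuousMap _ L.lyapunov)
        (integrable_const L.lyapunovBound) L.lyapunov_le_bound
      exact h.trans_eq (by simp)
    simpa using integral_mono (Kernel.integrable_continuousMap m _)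
      (integrable_const L.lyapunovBound) h3
  have h3 : ∑ S ∈ Finset.univ.erase (∅ : Finset ι), trembleWeight lam S *
      ∫ x, L.stepOp (L.setTremble S) L.lyapunov x ∂m ≤
      (1 - (1 - lam) ^ Fintype.card ι) * L.lyapunovBound := by
    rw [← eq_sub_iff_add_eq'.2 hw, Finset.sum_mul]
    exact Finset.sum_le_sum fun S _ =>
      mul_le_mul_of_nonneg_left (h2 S) (trembleWeight_nonneg hlam S)
  have hp0 : 0 ≤ (1 - lam) ^ Fintype.card ι := pow_nonneg (by linarith [hlam.2]) _
  have hp1 : (1 - lam) ^ Fintype.card ι ≤ 1 :=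
    pow_le_one₀ (by linarith [hlam.2]) (by linarith [hlam.1])
  have hVm : 0 ≤ ∫ x, L.lyapunov x ∂m := integral_nonneg L.lyapunov_nonneg
  have h4 := mul_le_mul_of_nonneg_left h1 hp0
  have h5 := mul_le_mul_of_nonneg_right hp1 (mul_nonneg hr0 hVm)
  linarith

theorem trembleWeight_singleton (lam : ℝ) (i : ι) :
    trembleWeight lam {i} = lam * (1 - lam) ^ (Fintype.card ι - 1) := by
  simp [trembleWeight]

theorem trembleWeight_le_sq {lam : ℝ} (hlam : lam ∈ Set.Icc (0 : ℝ) 1) {S : Finset ι}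
    (hS : 2 ≤ S.card) : trembleWeight lam S ≤ lam ^ 2 :=
  (mul_le_of_le_one_right (pow_nonneg hlam.1 _)
    (pow_le_one₀ (by linarith [hlam.2]) (by linarith [hlam.1]))).trans
    (pow_le_pow_of_le_one hlam.1 hlam.2 hS)

/-- For a function that is harmonic for the unperturbed chain, the steps without trembles drop out
of the balance equation, and the steps with at least two trembles are of order `lam ^ 2`. -/
theorem abs_integral_sub_singleTremble_le {lam : ℝ} (hlam : lam ∈ Set.Ioc (0 : ℝ) 1)
    {m : Measure L.State} [IsProbabilityMeasure m] (hm : (L.kernel lam).Invariant m)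
    {F : C(L.State, ℝ)} (hF : L.freeOp F = F) (hF0 : ∀ x, 0 ≤ F x) (hF1 : ∀ x, F x ≤ 1) :
    (1 - lam) ^ (Fintype.card ι - 1) * (Fintype.card ι *
      |∫ x, F x ∂m - ∫ x, L.stepOp L.singleTremble F x ∂m|) ≤
      2 ^ Fintype.card ι * lam := by
  have hlam' : lam ∈ Set.Icc (0 : ℝ) 1 := ⟨hlam.1.le, hlam.2⟩
  let a : ℝ := ∫ x, F x ∂m
  let k : Finset ι → ℝ := fun S => a - ∫ x, L.stepOp (L.setTremble S) F x ∂m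
  have hnonneg : ∀ (m' : Measure L.State), 0 ≤ ∫ x, F x ∂m' := fun m' => integral_nonneg hF0
  have hle1 : ∀ (m' : Measure L.State) [IsProbabilityMeasure m'], ∫ x, F x ∂m' ≤ 1 :=
    fun m' _ => by
      simpa using integral_mono (Kernel.integrable_continuousMap m' F) (integrable_const 1) hF1
  have hk : ∀ S, |k S| ≤ 1 := fun S => by
    have h0 : 0 ≤ ∫ x, L.stepOp (L.setTremble S) F x ∂m := integral_nonneg fun x => hnonneg _
    have h1 : ∫ x, L.stepOp (L.setTremble S) F x ∂m ≤ 1 := by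
      simpa using integral_mono (Kernel.integrable_continuousMap m _) (integrable_const 1)
        fun x => hle1 (L.stepKernel (L.setTremble S) x)
    have h2 : 0 ≤ a := hnonneg m
    have h3 : a ≤ 1 := hle1 m
    exact abs_le.2 ⟨by simp only [k]; linarith, by simp only [k]; linarith⟩
  have hbal : ∑ S : Finset ι, trembleWeight lam S * k S = 0 := by
    simp only [k, mul_sub, Finset.sum_sub_distrib]
    rw [← Finset.sum_mul, sum_trembleWeight, one_mul, sub_eq_zero]
    exact L.integral_eq_sum_of_invariant hlam' hm F
  have hempty : k ∅ = 0 := by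
    change a - ∫ x, L.freeOp F x ∂m = 0
    rw [hF, sub_self]
  -- split off the sets with at most one element
  have hsplit := Finset.sum_filter_add_sum_filter_not Finset.univ
    (fun S : Finset ι => 2 ≤ S.card) fun S => trembleWeight lam S * k S
  rw [hbal] at hsplit
  have hsmall : ∑ S ∈ Finset.univ.filter (fun S : Finset ι => ¬ 2 ≤ S.card),
      trembleWeight lam S * k S = ∑ i, trembleWeight lam {i} * k {i} := by
    refine Eq.trans ?_ (Finset.sum_map Finset.univ ⟨_, Finset.singleton_injective⟩
      fun S => trembleWeight lam S * k S)
    refine (Finset.sum_subset (fun S hS => ?_) fun S hS hS' => ?_).symm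
    · obtain ⟨i, -, rfl⟩ := Finset.mem_map.1 hS
      simp
    · have hcard : S.card < 2 := not_le.1 (Finset.mem_filter.1 hS).2
      obtain h0 | h1 : S.card = 0 ∨ S.card = 1 := by omega
      · rw [Finset.card_eq_zero.1 h0, hempty, mul_zero]
      · obtain ⟨i, rfl⟩ := Finset.card_eq_one.1 h1
        exact absurd (Finset.mem_map.2 ⟨i, Finset.mem_univ i, rfl⟩) hS'
  have hbig : |∑ S ∈ Finset.univ.filter (fun S : Finset ι => 2 ≤ S.card),
      trembleWeight lam S * k S| ≤ 2 ^ Fintype.card ι * lam ^ 2 := by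
    have h1 : ∀ S ∈ Finset.univ.filter (fun S : Finset ι => 2 ≤ S.card),
        |trembleWeight lam S * k S| ≤ lam ^ 2 := fun S hS => by
      rw [abs_mul, abs_of_nonneg (trembleWeight_nonneg hlam' S)]
      exact (mul_le_of_le_one_right (trembleWeight_nonneg hlam' S) (hk S)).trans
        (trembleWeight_le_sq hlam' (Finset.mem_filter.1 hS).2)
    refine (Finset.abs_sum_le_sum_abs _ _).trans ((Finset.sum_le_card_nsmul _ _ _ h1).trans ?_)
    rw [nsmul_eq_mul]
    refine mul_le_mul_of_nonneg_right ?_ (sq_nonneg lam)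
    have h2 := Finset.card_le_univ (Finset.univ.filter fun S : Finset ι => 2 ≤ S.card)
    rw [Fintype.card_finset] at h2
    exact_mod_cast h2
  have hn : (Fintype.card ι : ℝ) ≠ 0 := by exact_mod_cast Fintype.card_ne_zero
  have hsum : ∑ i, k {i} =
      Fintype.card ι * (a - ∫ x, L.stepOp L.singleTremble F x ∂m) := by
    simp_rw [stepOp_singleTremble_apply]
    rw [integral_const_mul,
      integral_finsetSum _ fun i _ => Kernel.integrable_continuousMap m _]
    simp only [k, Finset.sum_sub_distrib, Finset.sum_const, Finset.card_univ, nsmul_eq_mul]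
    field_simp
  simp_rw [hsmall, trembleWeight_singleton] at hsplit
  rw [← Finset.mul_sum, hsum] at hsplit
  rw [eq_neg_of_add_eq_zero_left hsplit, abs_neg, abs_mul, abs_mul, abs_mul,
    abs_of_pos hlam.1, abs_of_nonneg (pow_nonneg (by linarith [hlam.2]) _), Nat.abs_cast] at hbig
  refine le_of_mul_le_mul_left ?_ hlam.1
  calc _ = _ := by ring
    _ ≤ _ := hbig
    _ = _ := by ring

/-- The probabilities of the action profiles, as a probability vector on the pure states. -/
noncomputable def profileVector (m : ProbabilityMeasure L.State) : stdSimplex ℝ L.PureState :=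
  ⟨fun s => ∫ x, L.profileInd s.1.1 x ∂(m : Measure L.State),
    fun s => integral_nonneg (L.profileInd_nonneg _), by
      rw [← L.pureEquiv.sum_comp, ← integral_finsetSum _ fun a _ =>
        Kernel.integrable_continuousMap _ _]
      have h : ∀ x, ∑ a, L.profileInd a x = 1 := fun x => by simp [profileInd_apply]
      change ∫ x, ∑ a, L.profileInd a x ∂(m : Measure L.State) = 1
      simp [h]⟩

theorem profileVector_apply (m : ProbabilityMeasure L.State) (s : L.PureState) :
    (L.profileVector m).1 s = ∫ x, L.profileInd s.1.1 x ∂(m : Measure L.State) := rfl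

theorem sum_mul_profileInd (w : L.PureState → ℝ) (x : L.State) :
    ∑ s : L.PureState, w s * L.profileInd s.1.1 x = w (L.pure x.1) := by
  rw [← L.pureEquiv.sum_comp]
  change ∑ a, w (L.pure a) * L.profileInd a x = _
  simp [profileInd_apply]

variable {μ : ℝ → ProbabilityMeasure L.State}

theorem tendsto_integral_of_invariant
    (hμ : ∀ lam ∈ Set.Ioc (0 : ℝ) 1, (L.kernel lam).Invariant (μ lam : Measure L.State))
    {g : C(L.State, ℝ)} (hg : ∀ s : L.PureState, g s.1 = 0) :
    Tendsto (fun lam => ∫ x, g x ∂(μ lam : Measure L.State)) (𝓝[>] 0) (𝓝 0) := by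
  refine tendsto_integral_of_eq_zero_of_tendsto L.lyapunov_nonneg
    (fun x hx => hg ⟨x, L.lyapunov_eq_zero_iff.1 hx⟩) ?_
  obtain ⟨r, hr0, hr1, hr⟩ := L.exists_freeOp_lyapunov_le
  have hlim : Tendsto (fun lam : ℝ =>
      (1 - (1 - lam) ^ Fintype.card ι) * L.lyapunovBound / (1 - r)) (𝓝[>] 0) (𝓝 0) := by
    have hc : Continuous fun lam : ℝ =>
        (1 - (1 - lam) ^ Fintype.card ι) * L.lyapunovBound / (1 - r) := by fun_prop
    have h := hc.tendsto 0
    simp only [sub_zero, one_pow, sub_self, zero_mul, zero_div] at h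
    exact h.mono_left nhdsWithin_le_nhds
  refine squeeze_zero' (Eventually.of_forall fun lam => integral_nonneg L.lyapunov_nonneg) ?_ hlim
  filter_upwards [Ioc_mem_nhdsGT (zero_lt_one' ℝ)] with lam hlam
  rw [le_div_iff₀' (by linarith)]
  exact L.integral_lyapunov_le_of_invariant ⟨hlam.1.le, hlam.2⟩ (hμ lam hlam) hr0 hr

theorem tendsto_integral_sub_singleTremble
    (hμ : ∀ lam ∈ Set.Ioc (0 : ℝ) 1, (L.kernel lam).Invariant (μ lam : Measure L.State))
    (a : ∀ i, A i) :
    Tendsto (fun lam => ∫ x, L.limitProb a x ∂(μ lam : Measure L.State) -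
      ∫ x, L.stepOp L.singleTremble (L.limitProb a) x ∂(μ lam : Measure L.State))
      (𝓝[>] 0) (𝓝 0) := by
  have hn : (1 : ℝ) ≤ Fintype.card ι := by exact_mod_cast Fintype.card_pos
  have hlim : Tendsto (fun lam : ℝ =>
      2 ^ Fintype.card ι * lam / (1 - lam) ^ (Fintype.card ι - 1)) (𝓝[>] 0) (𝓝 0) := by
    have hc : ContinuousAt (fun lam : ℝ =>
        2 ^ Fintype.card ι * lam / (1 - lam) ^ (Fintype.card ι - 1)) 0 := by
      refine ContinuousAt.div (by fun_prop) (by fun_prop) (by simp)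
    have h := hc.tendsto
    simp only [mul_zero, zero_div] at h
    exact h.mono_left nhdsWithin_le_nhds
  refine squeeze_zero_norm' ?_ hlim
  filter_upwards [Ioo_mem_nhdsGT (zero_lt_one' ℝ)] with lam hlam
  have hlam' : lam ∈ Set.Ioc (0 : ℝ) 1 := ⟨hlam.1, hlam.2.le⟩
  have h := L.abs_integral_sub_singleTremble_le hlam' (hμ lam hlam') (L.freeOp_limitProb a)
    (L.limitProb_nonneg a) (L.limitProb_le_one a)
  rw [le_div_iff₀' (pow_pos (by linarith [hlam.2]) _), Real.norm_eq_abs]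
  refine le_trans (mul_le_mul_of_nonneg_left ?_ (pow_nonneg (by linarith [hlam.2]) _)) h
  exact le_mul_of_one_le_left (abs_nonneg _) hn

/-- The profile probabilities of the invariant measures are asymptotically stationary for the
tremble matrix. -/
theorem tendsto_vecMul_profileVector_sub
    (hμ : ∀ lam ∈ Set.Ioc (0 : ℝ) 1, (L.kernel lam).Invariant (μ lam : Measure L.State))
    (s' : L.PureState) :
    Tendsto (fun lam => Matrix.vecMul (L.profileVector (μ lam)).1 L.trembleMatrix s' -
      (L.profileVector (μ lam)).1 s') (𝓝[>] 0) (𝓝 0) := by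
  let F := L.limitProb s'.1.1
  let G := L.stepOp L.singleTremble F
  let H : C(L.State, ℝ) := ∑ s : L.PureState, L.trembleMatrix s s' • L.profileInd s.1.1
  have hH : ∀ x, H x = L.trembleMatrix (L.pure x.1) s' := fun x => by
    rw [← L.sum_mul_profileInd (fun s => L.trembleMatrix s s') x]
    simp [H]
  have hHint : ∀ lam, ∫ x, H x ∂(μ lam : Measure L.State) =
      Matrix.vecMul (L.profileVector (μ lam)).1 L.trembleMatrix s' := fun lam => by
    simp only [H, ContinuousMap.coe_sum, ContinuousMap.coe_smul, Finset.sum_apply, Pi.smul_apply,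
      smul_eq_mul]
    rw [integral_finsetSum _ fun s _ => (Kernel.integrable_continuousMap _ _).const_mul _]
    simp only [Matrix.vecMul, dotProduct, integral_const_mul, profileVector_apply]
    exact Finset.sum_congr rfl fun s _ => mul_comm _ _
  have h1 := L.tendsto_integral_of_invariant hμ (g := H - G) fun s => by
    rw [ContinuousMap.sub_apply, hH, pure_profile]
    exact sub_self _
  have h2 := L.tendsto_integral_of_invariant hμ (g := F - L.profileInd s'.1.1) fun s =>
    sub_eq_zero.2 (L.limitProb_of_lyapunov_eq_zero _ (L.lyapunov_pureState s))
  have h3 := (h1.sub (L.tendsto_integral_sub_singleTremble hμ s'.1.1)).add h2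
  simp only [sub_zero, add_zero] at h3
  refine h3.congr fun lam => ?_
  have hi := fun f : C(L.State, ℝ) => Kernel.integrable_continuousMap (μ lam : Measure L.State) f
  have e1 : ∫ x, (H - G) x ∂(μ lam : Measure L.State) = _ := integral_sub (hi H) (hi G)
  have e2 : ∫ x, (F - L.profileInd s'.1.1) x ∂(μ lam : Measure L.State) = _ :=
    integral_sub (hi F) (hi _)
  rw [e1, e2, hHint, profileVector_apply]
  ring

theorem integral_mixture (π : stdSimplex ℝ L.PureState) (f : C(L.State, ℝ)) :
    ∫ x, f x ∂(L.mixture π : Measure L.State) = ∑ s : L.PureState, π.1 s * f s.1 := by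
  change ∫ x, f x ∂(∑ s : L.PureState, ENNReal.ofReal (π.1 s) • Measure.dirac s.1) = _
  rw [integral_finsetSum_measure fun s _ =>
    (Kernel.integrable_continuousMap (Measure.dirac s.1) f).smul_measure ENNReal.ofReal_ne_top]
  refine Finset.sum_congr rfl fun s _ => ?_
  rw [integral_smul_measure, integral_dirac' _ _ f.continuous.stronglyMeasurable,
    ENNReal.toReal_ofReal (π.2.1 s), smul_eq_mul]

theorem tendsto_mixture_of_tendsto_profileVector
    (hμ : ∀ lam ∈ Set.Ioc (0 : ℝ) 1, (L.kernel lam).Invariant (μ lam : Measure L.State))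
    {π : stdSimplex ℝ L.PureState}
    (hπ : Tendsto (fun lam => L.profileVector (μ lam)) (𝓝[>] 0) (𝓝 π)) :
    Tendsto μ (𝓝[>] 0) (𝓝 (L.mixture π)) := by
  rw [ProbabilityMeasure.tendsto_iff_forall_integral_tendsto]
  intro φ
  let f : C(L.State, ℝ) := φ.toContinuousMap
  change Tendsto (fun lam => ∫ x, f x ∂(μ lam : Measure L.State)) _
    (𝓝 (∫ x, f x ∂(L.mixture π : Measure L.State)))
  -- `f` agrees on the pure states with a function of the profile
  let H : C(L.State, ℝ) := ∑ s : L.PureState, f s.1 • L.profileInd s.1.1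
  have hH : ∀ x, H x = f (L.pure x.1).1 := fun x => by
    rw [← L.sum_mul_profileInd (fun s => f s.1) x]
    simp [H]
  have h1 := L.tendsto_integral_of_invariant hμ (g := f - H) fun s => by
    rw [ContinuousMap.sub_apply, hH, pure_profile, sub_self]
  have h2 : Tendsto (fun lam => ∑ s : L.PureState, (L.profileVector (μ lam)).1 s * f s.1)
      (𝓝[>] 0) (𝓝 (∑ s : L.PureState, π.1 s * f s.1)) :=
    tendsto_finsetSum _ fun s _ => ((((continuous_apply s).comp
      continuous_subtype_val).tendsto π).comp hπ).mul_const _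
  rw [integral_mixture]
  have h3 := h1.add h2
  rw [zero_add] at h3
  refine h3.congr fun lam => ?_
  have hi := fun f : C(L.State, ℝ) => Kernel.integrable_continuousMap (μ lam : Measure L.State) f
  have e1 : ∫ x, (f - H) x ∂(μ lam : Measure L.State) = _ := integral_sub (hi f) (hi H)
  have e2 : ∫ x, H x ∂(μ lam : Measure L.State) =
      ∑ s : L.PureState, (L.profileVector (μ lam)).1 s * f s.1 := by
    simp only [H, ContinuousMap.coe_sum, ContinuousMap.coe_smul, Finset.sum_apply, Pi.smul_apply,
      smul_eq_mul]
    rw [integral_finsetSum _ fun s _ => (Kernel.integrable_continuousMap _ _).const_mul _]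
    simp only [integral_const_mul, profileVector_apply]
    exact Finset.sum_congr rfl fun s _ => mul_comm _ _
  rw [e1, e2]
  ring

theorem mixture_injective : Function.Injective L.mixture := by
  intro π π' h
  refine Subtype.ext (funext fun s => ?_)
  have h1 : ∀ q : stdSimplex ℝ L.PureState,
      ∫ x, L.profileInd s.1.1 x ∂(L.mixture q : Measure L.State) = q.1 s := fun q => by
    rw [integral_mixture, ← L.pureEquiv.sum_comp]
    change ∑ a, q.1 (L.pure a) * L.profileInd s.1.1 (L.pure a).1 = _
    have h2 : ∀ a, L.profileInd s.1.1 (L.pure a).1 = if a = s.1.1 then 1 else 0 := fun a => rfl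
    simp [h2, pure_profile]
  rw [← h1 π, h, h1 π']

end Invariant

end AspirationLearning

theorem theorem3p1 {ι : Type u} {A : ι → Type v} [Fintype ι] [DecidableEq ι] [Nonempty ι]
    [∀ i, Fintype (A i)] [∀ i, DecidableEq (A i)] [∀ i, Nonempty (A i)]
    [∀ i, TopologicalSpace (A i)] [∀ i, DiscreteTopology (A i)]
    [∀ i, MeasurableSpace (A i)] [∀ i, BorelSpace (A i)]
    (L : AspirationLearning ι A) :
    ∃ Phat : Matrix L.PureState L.PureState ℝ,
      L.IsTrembleMatrix Phat ∧
      (∀ s s', 0 ≤ Phat s s') ∧ (∀ s, ∑ s', Phat s s' = 1) ∧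
      ∃ π : stdSimplex ℝ L.PureState,
        L.IsLimitVector π ∧
        (∀ π' : stdSimplex ℝ L.PureState, L.IsLimitVector π' → π' = π) ∧
        Matrix.vecMul π.1 Phat = π.1 ∧
        (∀ π' : stdSimplex ℝ L.PureState, Matrix.vecMul π'.1 Phat = π'.1 → π' = π) := by
  refine ⟨L.trembleMatrix, L.isTrembleMatrix_trembleMatrix, L.trembleMatrix_nonneg,
    L.sum_trembleMatrix, ?_⟩
  have huniq := fun {x y : stdSimplex ℝ L.PureState} =>
    Matrix.stdSimplex_eq_of_vecMul_eq_self (x := x) (y := y) L.trembleMatrix_nonneg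
      L.trembleMatrix_irreducible
  -- a family of invariant measures, extended arbitrarily outside `(0, 1]`
  have hex : ∀ lam : ℝ, ∃ m : ProbabilityMeasure L.State, lam ∈ Set.Ioc (0 : ℝ) 1 →
      (L.kernel lam).Invariant (m : Measure L.State) := fun lam => by
    by_cases hlam : lam ∈ Set.Ioc (0 : ℝ) 1
    · obtain ⟨m, hm⟩ := L.exists_invariant_kernel ⟨hlam.1.le, hlam.2⟩
      exact ⟨m, fun _ => hm⟩
    · exact ⟨(L.exists_invariant_kernel ⟨le_rfl, zero_le_one⟩).choose, fun h => absurd h hlam⟩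
  choose μ₀ hμ₀ using hex
  have hasym := fun {μ : ℝ → ProbabilityMeasure L.State} hμ =>
    Matrix.exists_tendsto_stdSimplex L.trembleMatrix_nonneg L.trembleMatrix_irreducible
      (L.tendsto_vecMul_profileVector_sub (μ := μ) hμ)
  obtain ⟨π, hπ, -⟩ := hasym hμ₀
  have hlimit : L.IsLimitVector π := fun μ hμ => by
    obtain ⟨π', hπ', hlim⟩ := hasym hμ
    rw [huniq hπ' hπ] at hlim
    exact L.tendsto_mixture_of_tendsto_profileVector hμ hlim
  refine ⟨π, hlimit, fun π' hπ' => ?_, hπ, fun π' hπ' => huniq hπ' hπ⟩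
  -- both vectors describe the limit of the family `μ₀`
  have : T2Space (ProbabilityMeasure L.State) := by
    let _ : MetricSpace L.State := TopologicalSpace.metrizableSpaceMetric L.State
    infer_instance
  exact L.mixture_injective (tendsto_nhds_unique (hπ' μ₀ hμ₀) (hlimit μ₀ hμ₀))
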